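/- Let $n\in\{0,1,2,\dots\}\cup\{\infty\}$. **Cartesian closure.** Let $\mathcal F$ be a category of topological spaces and continuous maps which contains all constant maps and all open subspaces of its objects with their inclusions, and whose morphisms are determined locally. An object $X$ of $\bar{\mathcal F}$ is a set $|X|$ with, for each $H\in\mathcal F$, a set of maps $d:|H|\to|X|$ (the figures of type $H$) that is closed under precomposition with morphisms $J\to H$ of $\mathcal F$, contains the constant maps, and contains every map that is locally (on an open cover of $H$) a figure. Arrows of $\bar{\mathcal F}$ are the maps sending figures to figures. $X$ carries the final topology of its figures; a subset $S\subseteq |X|$ is a space $(S\prec X)$ whose figures are the figures of $X$ with values in $S$; the figures of $X\times Y$ are the maps both of whose components are figures; $\bar K$, for $K\in\mathcal F$, has as figures the morphisms of $\mathcal F$ into $K$. **$\mathcal C^n$ spaces.** $\mathcal C^n:=\bar{\mathcal F}$ for $\mathcal F$ the category of open subsets of the spaces $\mathbb R^u$ and $C^n$ maps. A finite-dimensional $C^n$ manifold $M$ without boundary (no separation or countability assumption) is identified with the $\mathcal C^n$ space $M$ whose figures are the $C^n$ maps $H\to M$. An observable of $X$ is an arrow $\varphi:(U\prec X)\to\bar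 K$ with $U$ open in $X$ and $K$ open in some $\mathbb R^k$. A map $x:\mathbb R\to X$, continuous at $0$, is nilpotent if for every observable $\varphi$ on $U\ni x(0)$ there is $k\in\mathbb N$ with $\|\varphi(x(t))-\varphi(x(0))\|^k=o(t)$ for $t\to0$. For nilpotent $x,y$, write $x\sim y$ if for every observable $\varphi:U\to K$ one has $x(0)\in U\Leftrightarrow y(0)\in U$, and, if $x(0)\in U$, $\varphi(x(t))=\varphi(y(t))+o(t)$. The set ${}^\bullet X$ is the set of nilpotent maps modulo $\sim$; for an arrow $f$ of $\mathcal C^n$, ${}^\bullet f([x])=[f\circ x]$. **Extended spaces.** ${}^\bullet\mathcal C^n:=\bar{\mathcal F}$ where now $\mathcal F$ has as objects the subsets $S\subseteq{}^\bullet(\mathbb R^s)$, $s\in\mathbb N$, with the topology generated by the sets ${}^\bullet U\cap S$, $U$ open in $\mathbb R^s$, and as morphisms $S\to T\subseteq{}^\bullet(\mathbb R^t)$ the maps $f$ such that for each $s_0\in S$ there are $q\in\mathbb N$, $p\in{}^\bullet(\mathbb R^{q})$, open sets $U\subseteq\mathbb R^q$, $V\subseteq\mathbb R^s$ with $p\in{}^\bullet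 U$, $s_0\in{}^\bullet V$, and a $C^n$ map $g:U\times V\to\mathbb R^t$ with $f(x)={}^\bullet g\langle p,x\rangle$ for all $x\in{}^\bullet V\cap S$, where $\langle p,x\rangle\in{}^\bullet(U\times V)$ is the point with components $p$ and $x$. For a $\mathcal C^n$ space $X$ the extended space ${}^\bullet X$ is the set ${}^\bullet X$ with the structure generated by the maps $d:T\to{}^\bullet X$ ($T\subseteq{}^\bullet(\mathbb R^t)$) that are constant or of the form $d={}^\bullet h|_T$ for a figure $h:V\to X$ with $V$ open in $\mathbb R^t$ and $T\subseteq{}^\bullet V$: its figures are the maps that are locally of the form $d\circ f$ with $f$ a morphism of $\mathcal F$ and $d$ such a map. **Theorem.** Let $M$ and $N$ be $C^n$ manifolds. Then $$\alpha:{}^\bullet M\times{}^\bullet N\to{}^\bullet(M\times N),\quad ([x],[y])\mapsto[(x,y)],$$ $$\beta:{}^\bullet(M\times N)\to{}^\bullet M\times{}^\bullet N,\quad [z]\mapsto([p_M\circ z],[p_N\circ z]),$$ where $p_M,p_N$ are the projections, are well defined, inverse to each other, and both are arrows of ${}^\bullet\mathcal C^n$. Hence ${}^\bullet(M\times N)\simeq{}^\bullet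 M\times{}^\bullet N$ in ${}^\bullet\mathcal C^n$, and the functor ${}^\bullet(-):\mathcal C^n\to{}^\bullet\mathcal C^n$ preserves the product of $M$ and $N$. -/

import Mathlib

open Set Filter Topology Asymptotics CategoryTheory
open scoped Manifold ContDiff

universe u v w

noncomputable section

namespace ExtCn

/-- The Euclidean space `ℝ^k`. -/
abbrev Euc (k : ℕ) : Type := EuclideanSpace ℝ (Fin k)

/-! ### Concrete categories of topological spaces and their cartesian closures -/

/-- A concrete category of topological spaces whose objects are subsets (with the induced topology)
of given ambient spaces `Amb 0, Amb 1, …`.  `IsMor S f` says that `f : S → Amb l` is a morphism;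
the morphisms `S ⟶ T` are the maps `S → T` which are morphisms as maps into the ambient space
of `T`.  All open subspaces, their inclusions and all constant maps belong to the category, the
morphisms are continuous, and being a morphism is a local property. -/
structure FigCat where
  Amb : ℕ → Type
  top : ∀ k, TopologicalSpace (Amb k)
  IsObj : ∀ {k : ℕ}, Set (Amb k) → Prop
  IsMor : ∀ {k l : ℕ} (S : Set (Amb k)), (S → Amb l) → Prop
  isObj_inter : ∀ {k : ℕ} {S U : Set (Amb k)}, IsObj S → IsOpen U → IsObj (S ∩ U)
  mor_val : ∀ {k : ℕ} {S : Set (Amb k)}, IsObj S → IsMor S (Subtype.val : S → Amb k)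
  mor_comp : ∀ {k l m : ℕ} {S : Set (Amb k)} {T : Set (Amb l)} {f : S → T} {g : T → Amb m},
    IsObj S → IsObj T → IsMor S (fun x => (f x : Amb l)) → IsMor T g → IsMor S (fun x => g (f x))
  mor_const : ∀ {k l : ℕ} {S : Set (Amb k)} (c : Amb l), IsObj S → IsMor S (fun _ => c)
  mor_cont : ∀ {k l : ℕ} {S : Set (Amb k)} {f : S → Amb l}, IsObj S → IsMor S f → Continuous f
  mor_local : ∀ {k l : ℕ} {S : Set (Amb k)} {f : S → Amb l}, IsObj S →
    (∀ x : S, ∃ U : Set (Amb k), IsOpen U ∧ (x : Amb k) ∈ U ∧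
      IsMor (S ∩ U) (fun y => f (Set.inclusion Set.inter_subset_left y))) → IsMor S f

attribute [instance] FigCat.top

/-- An object of the category `F`. -/
structure FigCat.Obj (F : FigCat) where
  dim : ℕ
  set : Set (F.Amb dim)
  isObj : F.IsObj set

namespace FigCat

variable {F : FigCat}

/-- The open subspace `U ∩ H` of `H`. -/
def Obj.sub (H : F.Obj) (U : Set (F.Amb H.dim)) (hU : IsOpen U) : F.Obj :=
  ⟨H.dim, H.set ∩ U, F.isObj_inter H.isObj hU⟩

/-- The inclusion of an open subspace. -/
def Obj.incl (H : F.Obj) (U : Set (F.Amb H.dim)) (hU : IsOpen U) (x : (H.sub U hU).set) : H.set :=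
  ⟨x.1, x.2.1⟩

/-- `f : H ⟶ K` in the category `F`. -/
def IsHom (H K : F.Obj) (f : H.set → K.set) : Prop :=
  F.IsMor H.set (fun x => (f x : F.Amb K.dim))

theorem IsHom.comp {H J K : F.Obj} {g : J.set → K.set} {f : H.set → J.set} (hg : IsHom J K g)
    (hf : IsHom H J f) : IsHom H K (fun x => g (f x)) :=
  F.mor_comp (g := fun y => (g y : F.Amb K.dim)) H.isObj J.isObj hf hg

theorem isHom_incl (H : F.Obj) (U : Set (F.Amb H.dim)) (hU : IsOpen U) :
    IsHom (H.sub U hU) H (H.incl U hU) :=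
  F.mor_val (H.sub U hU).isObj

end FigCat

/-- A space of the cartesian closure of `F`: a set with, for each `H` in `F`, a set of figures
`d : H → X`, which is closed under reparametrisation by morphisms of `F`, contains the constant
maps and has the sheaf property. -/
structure FSpace (F : FigCat) where
  carrier : Type u
  IsFig : ∀ H : F.Obj, (H.set → carrier) → Prop
  fig_comp : ∀ {H J : F.Obj} {f : J.set → H.set} {d : H.set → carrier},
    FigCat.IsHom J H f → IsFig H d → IsFig J (fun x => d (f x))
  fig_const : ∀ (H : F.Obj) (c : carrier), IsFig H (fun _ => c)
  fig_sheaf : ∀ {H : F.Obj} {d : H.set → carrier},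
    (∀ x : H.set, ∃ (U : Set (F.Amb H.dim)) (hU : IsOpen U), (x : F.Amb H.dim) ∈ U ∧
      IsFig (H.sub U hU) (fun y => d (H.incl U hU y))) → IsFig H d

namespace FSpace

variable {F : FigCat}

/-- The maps which send figures to figures. -/
def IsArrow (X : FSpace.{u} F) (Y : FSpace.{v} F) (f : X.carrier → Y.carrier) : Prop :=
  ∀ (H : F.Obj) (d : H.set → X.carrier), X.IsFig H d → Y.IsFig H (fun x => f (d x))

/-- Arrows of the cartesian closure of `F`. -/
@[ext] structure Hom (X Y : FSpace.{u} F) where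
  toFun : X.carrier → Y.carrier
  isArrow : IsArrow X Y toFun

instance : Category.{u} (FSpace.{u} F) where
  Hom X Y := Hom X Y
  id X := ⟨fun x => x, fun _ _ h => h⟩
  comp f g := ⟨fun x => g.toFun (f.toFun x), fun H d h => g.isArrow H _ (f.isArrow H d h)⟩

/-- The final topology with respect to all figures. -/
@[reducible] def topology (X : FSpace.{u} F) : TopologicalSpace X.carrier where
  IsOpen U := ∀ (H : F.Obj) (d : H.set → X.carrier), X.IsFig H d → IsOpen (d ⁻¹' U)
  isOpen_univ _ _ _ := isOpen_univ
  isOpen_inter _ _ hU hV H d hd := (hU H d hd).inter (hV H d hd)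
  isOpen_sUnion S hS H d hd := by
    rw [Set.preimage_sUnion]
    exact isOpen_biUnion fun U hU => hS U hU H d hd

/-- The subspace induced on `S ⊆ X`. -/
abbrev sub (X : FSpace.{u} F) (S : Set X.carrier) : FSpace.{u} F where
  carrier := S
  IsFig H d := X.IsFig H (fun x => (d x : X.carrier))
  fig_comp hf hd := X.fig_comp hf hd
  fig_const H c := X.fig_const H c
  fig_sheaf h := X.fig_sheaf h

/-- The product of two spaces. -/
abbrev prod (X : FSpace.{u} F) (Y : FSpace.{v} F) : FSpace.{max u v} F where
  carrier := X.carrier × Y.carrier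
  IsFig H d := X.IsFig H (fun x => (d x).1) ∧ Y.IsFig H (fun x => (d x).2)
  fig_comp hf hd := ⟨X.fig_comp hf hd.1, Y.fig_comp hf hd.2⟩
  fig_const H c := ⟨X.fig_const H c.1, Y.fig_const H c.2⟩
  fig_sheaf h := ⟨X.fig_sheaf fun x => (h x).imp fun _ ⟨hU, hx, hd⟩ => ⟨hU, hx, hd.1⟩,
    Y.fig_sheaf fun x => (h x).imp fun _ ⟨hU, hx, hd⟩ => ⟨hU, hx, hd.2⟩⟩

/-- The space `K̄` of an object `K` of `F`: its figures are the morphisms with values in `K`. -/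
abbrev repr (K : F.Obj) : FSpace.{0} F where
  carrier := K.set
  IsFig H d := FigCat.IsHom H K d
  fig_comp hf hd := hd.comp hf
  fig_const H c := F.mor_const (c : F.Amb K.dim) H.isObj
  fig_sheaf {H _} h := F.mor_local H.isObj fun x => (h x).imp fun _ ⟨hU, hx, hd⟩ => ⟨hU, hx, hd⟩

/-- The space generated by a family `D` of maps which contains the constant ones: its figures are
locally composites of a morphism of `F` with an element of the family. -/
def generated (X : Type u) (D : ∀ K : F.Obj, (K.set → X) → Prop)
    (hD : ∀ (K : F.Obj) (c : X), D K (fun _ => c)) : FSpace.{u} F where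
  carrier := X
  IsFig H δ := ∀ x : H.set, ∃ (U : Set (F.Amb H.dim)) (hU : IsOpen U), (x : F.Amb H.dim) ∈ U ∧
    ∃ (K : F.Obj) (d : K.set → X) (f : (H.sub U hU).set → K.set), D K d ∧
      FigCat.IsHom (H.sub U hU) K f ∧ ∀ y, δ (H.incl U hU y) = d (f y)
  fig_comp {H J f δ} hf hδ x := by
    obtain ⟨U, hU, hxU, K, d, g, hd, hg, hgd⟩ := hδ (f x)
    have hc : Continuous (fun y => (f y : F.Amb H.dim)) := F.mor_cont J.isObj hf
    obtain ⟨V, hV, hVU⟩ := isOpen_induced_iff.1 (hU.preimage hc)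
    have hmem : ∀ y : (J.sub V hV).set, (f (J.incl V hV y) : F.Amb H.dim) ∈ U := fun y => by
      have : J.incl V hV y ∈ (Subtype.val ⁻¹' V : Set J.set) := y.2.2
      rw [hVU] at this
      exact this
    refine ⟨V, hV, ?_, K, d, fun y => g ⟨(f (J.incl V hV y)).1, (f _).2, hmem y⟩, hd, ?_, ?_⟩
    · have : x ∈ (fun y => (f y : F.Amb H.dim)) ⁻¹' U := hxU
      rw [← hVU] at this
      exact this
    · exact FigCat.IsHom.comp (J := H.sub U hU) (K := K) (H := J.sub V hV) (g := g)
        (f := fun y => ⟨(f (J.incl V hV y)).1, (f _).2, hmem y⟩) hg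
        (FigCat.IsHom.comp (H := J.sub V hV) hf (FigCat.isHom_incl J V hV))
    · intro y
      exact hgd ⟨(f (J.incl V hV y)).1, (f _).2, hmem y⟩
  fig_const H c x := ⟨univ, isOpen_univ, mem_univ _, H, fun _ => c, H.incl univ isOpen_univ, hD H c,
    FigCat.isHom_incl H _ _, fun _ => rfl⟩
  fig_sheaf {H δ} h x := by
    obtain ⟨U, hU, hxU, h⟩ := h x
    obtain ⟨V, hV, hxV, K, d, f, hd, hf, hfd⟩ := h ⟨x.1, x.2, hxU⟩
    refine ⟨U ∩ V, hU.inter hV, ⟨hxU, hxV⟩, K, d,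
      fun y => f ⟨y.1, ⟨y.2.1, y.2.2.1⟩, y.2.2.2⟩, hd, ?_, ?_⟩
    · exact FigCat.IsHom.comp (H := H.sub (U ∩ V) (hU.inter hV)) (J := (H.sub U hU).sub V hV) hf
        (f := fun y => ⟨y.1, ⟨y.2.1, y.2.2.1⟩, y.2.2.2⟩)
        (F.mor_val (H.sub (U ∩ V) (hU.inter hV)).isObj)
    · intro y
      exact hfd ⟨y.1, ⟨y.2.1, y.2.2.1⟩, y.2.2.2⟩

theorem IsArrow.continuous {X : FSpace.{u} F} {Y : FSpace.{v} F} {f : X.carrier → Y.carrier}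
    (hf : IsArrow X Y f) : @Continuous _ _ X.topology Y.topology f :=
  @Continuous.mk _ _ X.topology Y.topology f fun _ hU H d hd => hU H _ (hf H d hd)

theorem isArrow_of_isFig {X : FSpace.{u} F} {K : F.Obj} {d : K.set → X.carrier}
    (hd : X.IsFig K d) : IsArrow (repr K) X d := fun _ _ hf => X.fig_comp hf hd

end FSpace

/-! ### The category `Cⁿ` -/

/-- The category of open sets of the spaces `ℝ^k` and `Cⁿ` maps. -/
abbrev OR (n : ℕ∞) : FigCat where
  Amb := Euc
  top _ := inferInstance
  IsObj S := IsOpen S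
  IsMor {k l} S f := ∃ g : Euc k → Euc l, ContDiffOn ℝ n g S ∧ ∀ x : S, f x = g x
  isObj_inter hS hU := hS.inter hU
  mor_val _ := ⟨id, contDiff_id.contDiffOn, fun _ => rfl⟩
  mor_comp {k l m S T f g} _ _ := by
    rintro ⟨f', hf', hff⟩ ⟨g', hg', hgg⟩
    refine ⟨g' ∘ f', hg'.comp hf' ?_, fun x => ?_⟩
    · intro x hx
      have := hff ⟨x, hx⟩
      rw [← this]
      exact (f ⟨x, hx⟩).2
    · simp only [Function.comp, hgg, hff]
  mor_const c _ := ⟨fun _ => c, contDiffOn_const, fun _ => rfl⟩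
  mor_cont {k l S f} _ := by
    rintro ⟨f', hf', hff⟩
    have : f = fun x : S => f' x := funext hff
    rw [this]
    exact hf'.continuousOn.domRestrict
  mor_local {k l S f} hS h := by
    classical
    refine ⟨fun x => if hx : x ∈ S then f ⟨x, hx⟩ else 0, ?_, fun x => by simp⟩
    intro x hx
    obtain ⟨U, hU, hxU, g, hg, hfg⟩ := h ⟨x, hx⟩
    have hmem : S ∩ U ∈ 𝓝 x := (hS.inter hU).mem_nhds ⟨hx, hxU⟩
    refine ((hg.contDiffAt hmem).congr_of_eventuallyEq ?_).contDiffWithinAt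
    filter_upwards [hmem] with y hy
    rw [dif_pos hy.1]
    exact hfg ⟨y, hy⟩

/-- The category of `Cⁿ` spaces. -/
abbrev Cn (n : ℕ∞) : Type (u + 1) := FSpace.{u} (OR n)

/-- The `Cⁿ` space `M̄` of a manifold `M`: the figures `H → M` are the maps of class `Cⁿ` on the
open set `H`. -/
abbrev ofManifold (n : ℕ∞) {E : Type v} [NormedAddCommGroup E] [NormedSpace ℝ E] {B : Type w}
    [TopologicalSpace B] (I : ModelWithCorners ℝ E B) (M : Type u) [TopologicalSpace M]
    [ChartedSpace B M] : Cn.{u} n where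
  carrier := M
  IsFig H d := H.set.Nonempty →
    ∃ g : Euc H.dim → M, ContMDiffOn 𝓘(ℝ, Euc H.dim) I n g H.set ∧ ∀ x : H.set, d x = g x
  fig_comp {H J f d} := by
    rintro ⟨f', hf', hff⟩ hd ⟨x, hx⟩
    obtain ⟨g, hg, hdg⟩ := hd ⟨f ⟨x, hx⟩, (f ⟨x, hx⟩).2⟩
    refine ⟨g ∘ f', hg.comp hf'.contMDiffOn ?_, fun x => ?_⟩
    · intro x hx
      have := hff ⟨x, hx⟩
      simp only [mem_preimage]
      rw [← this]
      exact (f ⟨x, hx⟩).2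
    · simp only [Function.comp, hdg, hff]
  fig_const H c _ := ⟨fun _ => c, contMDiffOn_const, fun _ => rfl⟩
  fig_sheaf {H d} h := by
    classical
    rintro ⟨x₀, hx₀⟩
    refine ⟨fun x => if hx : x ∈ H.set then d ⟨x, hx⟩ else d ⟨x₀, hx₀⟩, ?_, fun x => by simp⟩
    intro x hx
    obtain ⟨U, hU, hxU, h⟩ := h ⟨x, hx⟩
    obtain ⟨g, hg, hfg⟩ := h ⟨x, hx, hxU⟩
    have hmem : H.set ∩ U ∈ 𝓝 x := (IsOpen.inter H.isObj hU).mem_nhds ⟨hx, hxU⟩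
    refine ((hg.contMDiffAt hmem).congr_of_eventuallyEq ?_).contMDiffWithinAt
    filter_upwards [hmem] with y hy
    rw [dif_pos hy.1]
    exact hfg ⟨y, hy⟩

/-- The normed space `E` as a `Cⁿ` space. -/
abbrev vec (n : ℕ∞) (E : Type u) [NormedAddCommGroup E] [NormedSpace ℝ E] : Cn.{u} n :=
  ofManifold n 𝓘(ℝ, E) E

/-! ### Nilpotent paths and the extension of `Cⁿ` spaces -/

/-- `c` is an observable on the zone `UK` of `X`, i.e. `U` is open in `X`, `K` is open in some `ℝ^k`
and `c : U → K` is an arrow of `Cⁿ`.  Only the values of `c` on `U` matter. -/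
structure IsObservable {n : ℕ∞} (X : Cn.{u} n) (U : Set X.carrier) (K : (OR n).Obj)
    (c : X.carrier → Euc K.dim) : Prop where
  isOpen : IsOpen[X.topology] U
  mapsTo : MapsTo c U K.set
  isArrow : FSpace.IsArrow (X.sub U) (FSpace.repr K) mapsTo.restrict

theorem IsObservable.comp {n : ℕ∞} {X : Cn.{u} n} {Y : Cn.{v} n} {f : X.carrier → Y.carrier}
    (hf : FSpace.IsArrow X Y f) {U : Set Y.carrier} {K : (OR n).Obj} {c : Y.carrier → Euc K.dim}
    (hc : IsObservable Y U K c) : IsObservable X (f ⁻¹' U) K (fun x => c (f x)) where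
  isOpen := @IsOpen.preimage _ _ X.topology Y.topology f hf.continuous U hc.isOpen
  mapsTo _ hx := hc.mapsTo hx
  isArrow H d hd := hc.isArrow H (fun x => ⟨f (d x).1, (d x).2⟩) (hf H _ hd)

/-- Nilpotent paths of a `Cⁿ` space. -/
structure IsNilPath {n : ℕ∞} (X : Cn.{u} n) (x : ℝ → X.carrier) : Prop where
  continuousAt : @ContinuousAt _ _ _ X.topology x 0
  nilpotent : ∀ (U : Set X.carrier) (K : (OR n).Obj) (φ : X.carrier → Euc K.dim),
    IsObservable X U K φ → x 0 ∈ U →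
      ∃ k : ℕ, (fun t => ‖φ (x t) - φ (x 0)‖ ^ k) =o[𝓝[≠] 0] (fun t : ℝ => t)

/-- The nilpotent paths of `X`. -/
abbrev NilPath {n : ℕ∞} (X : Cn.{u} n) : Type u := {x : ℝ → X.carrier // IsNilPath X x}

/-- Equality up to `o(t)`, tested with all observables. -/
def Sim {n : ℕ∞} (X : Cn.{u} n) (x y : ℝ → X.carrier) : Prop :=
  ∀ (U : Set X.carrier) (K : (OR n).Obj) (φ : X.carrier → Euc K.dim), IsObservable X U K φ →
    (x 0 ∈ U ↔ y 0 ∈ U) ∧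
    (x 0 ∈ U → (fun t => φ (x t) - φ (y t)) =o[𝓝[≠] 0] (fun t : ℝ => t))

/-- `Sim` is an equivalence relation on nilpotent paths. -/
instance simSetoid {n : ℕ∞} (X : Cn.{u} n) : Setoid (NilPath X) where
  r x y := Sim X x.1 y.1
  iseqv :=
    { refl := fun x U K φ _ => ⟨Iff.rfl, fun _ => by simp⟩
      symm := fun {x y} h U K φ hφ => ⟨(h U K φ hφ).1.symm, fun hy => by
        simpa using ((h U K φ hφ).2 ((h U K φ hφ).1.2 hy)).neg_left⟩
      trans := fun {x y z} h h' U K φ hφ => ⟨(h U K φ hφ).1.trans (h' U K φ hφ).1, fun hx => by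
        simpa using ((h U K φ hφ).2 hx).add ((h' U K φ hφ).2 ((h U K φ hφ).1.1 hx))⟩ }

/-- The set of points of the extension `·X`. -/
def ExtPt {n : ℕ∞} (X : Cn.{u} n) : Type u := Quotient (simSetoid X)

/-- The class of a nilpotent path. -/
def ExtPt.mk {n : ℕ∞} {X : Cn.{u} n} (x : ℝ → X.carrier) (hx : IsNilPath X x) : ExtPt X :=
  Quotient.mk (simSetoid X) ⟨x, hx⟩

theorem IsNilPath.map {n : ℕ∞} {X : Cn.{u} n} {Y : Cn.{v} n} {f : X.carrier → Y.carrier}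
    (hf : FSpace.IsArrow X Y f) {x : ℝ → X.carrier} (hx : IsNilPath X x) :
    IsNilPath Y (fun t => f (x t)) := by
  refine ⟨?_, fun U K φ hφ h0 => ?_⟩
  · exact Filter.Tendsto.comp (y := @nhds _ X.topology (x 0))
      (@Continuous.continuousAt _ _ X.topology Y.topology f (x 0) hf.continuous) hx.continuousAt
  · exact hx.nilpotent (f ⁻¹' U) K (fun y => φ (f y)) (hφ.comp hf) h0

/-- The extension `·f : ·X → ·Y` of an arrow `f : X → Y` of `Cⁿ`. -/
def ExtPt.map {n : ℕ∞} {X : Cn.{u} n} {Y : Cn.{v} n} (f : X.carrier → Y.carrier)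
    (hf : FSpace.IsArrow X Y f) : ExtPt X → ExtPt Y :=
  Quotient.map (fun x => ⟨fun t => f (x.1 t), x.2.map hf⟩)
    fun _ _ h U K φ hφ => h (f ⁻¹' U) K (fun y => φ (f y)) (hφ.comp hf)

theorem IsNilPath.congr {n : ℕ∞} {X : Cn.{u} n} {x y : ℝ → X.carrier} (hx : IsNilPath X x)
    (h : y =ᶠ[𝓝 0] x) : IsNilPath X y := by
  have h0 : y 0 = x 0 := h.self_of_nhds
  refine ⟨?_, fun U K φ hφ hy => ?_⟩
  · have := hx.continuousAt
    unfold ContinuousAt at this ⊢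
    rw [h0]
    exact Filter.Tendsto.congr' h.symm this
  · rw [h0] at hy
    obtain ⟨k, hk⟩ := hx.nilpotent U K φ hφ hy
    refine ⟨k, hk.congr' ?_ EventuallyEq.rfl⟩
    filter_upwards [h.filter_mono nhdsWithin_le_nhds] with t ht
    rw [ht, h0]

theorem ExtPt.mk_eq_of_eventuallyEq {n : ℕ∞} {X : Cn.{u} n} {x y : ℝ → X.carrier}
    (hx : IsNilPath X x) (hy : IsNilPath X y) (h : x =ᶠ[𝓝 0] y) :
    ExtPt.mk x hx = ExtPt.mk y hy := by
  refine Quotient.sound (s := simSetoid X) fun U K φ _ => ⟨?_, fun _ => ?_⟩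
  · show x 0 ∈ U ↔ y 0 ∈ U
    rw [show x 0 = y 0 from h.self_of_nhds]
  · refine (isLittleO_zero (fun t : ℝ => t) _).congr' ?_ EventuallyEq.rfl
    filter_upwards [h.filter_mono nhdsWithin_le_nhds] with t ht
    rw [ht, sub_self]

/-! ### Open subsets of normed spaces -/

section Vec

variable {n : ℕ∞} {E : Type v} [NormedAddCommGroup E] [NormedSpace ℝ E]
  {G : Type w} [NormedAddCommGroup G] [NormedSpace ℝ G]

/-- A `Cⁿ` map on `W` is an arrow of `Cⁿ` on the subspace `W`. -/
theorem isArrow_of_contDiffOn {W : Set E} {g : E → G} (hg : ContDiffOn ℝ n g W) :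
    FSpace.IsArrow ((vec n E).sub W) (vec n G) (fun z => g z.1) := by
  intro H d hd hne
  obtain ⟨f, hf, hdf⟩ := hd hne
  refine ⟨g ∘ f, hg.contMDiffOn.comp hf fun x hx => ?_, fun x => ?_⟩
  · have := hdf ⟨x, hx⟩
    simp only [mem_preimage]
    rw [← this]
    exact (d ⟨x, hx⟩).2
  · simp only [Function.comp, hdf]

/-- `Y` is, through the injection `v`, the space of an open subset `W` of `E`. -/
structure IsOpenVec (Y : Cn.{u} n) (v : Y.carrier → E) (W : Set E) : Prop where
  inj : Function.Injective v
  range : Set.range v = W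
  isOpen : IsOpen W
  fig : ∀ (H : (OR n).Obj) (d : H.set → Y.carrier),
    Y.IsFig H d ↔ (vec n E).IsFig H (fun x => v (d x))

theorem isOpenVec_vec : IsOpenVec (vec n E) (fun x => x) (univ : Set E) :=
  ⟨fun _ _ h => h, by simp, isOpen_univ, fun _ _ => Iff.rfl⟩

theorem isOpenVec_sub {W : Set E} (hW : IsOpen W) :
    IsOpenVec ((vec n E).sub W) (fun x => x.1) W :=
  ⟨Subtype.val_injective, Subtype.range_val, hW, fun _ _ => Iff.rfl⟩

/-- Germs at `0` of nilpotent paths in a normed space. -/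
def NilGerm (n : ℕ∞) (y : ℝ → E) : Prop :=
  ContinuousAt y 0 ∧ (n = 0 → ∀ᶠ t in 𝓝 0, y t = y 0) ∧
    ∃ k : ℕ, (fun t => ‖y t - y 0‖ ^ k) =o[𝓝[≠] 0] (fun t : ℝ => t)

/-- If all continuous functions of a path are nilpotent, then the path is locally constant. -/
theorem eventually_const {y : ℝ → E}
    (h : ∀ ψ : E → ℝ, Continuous ψ →
      ∃ k : ℕ, (fun t => ‖ψ (y t) - ψ (y 0)‖ ^ k) =o[𝓝[≠] 0] (fun t : ℝ => t)) :
    ∀ᶠ t in 𝓝 0, y t = y 0 := by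
  by_contra hcon
  have hfreq : ∃ᶠ t in 𝓝 0, y t ≠ y 0 := not_eventually.1 hcon
  have hex : ∀ j : ℕ, ∃ t : ℝ, |t| < (1 / 2) ^ (j * j) ∧ y t ≠ y 0 := fun j => by
    have hev : ∀ᶠ t : ℝ in 𝓝 0, |t| < (1 / 2) ^ (j * j) := by
      have : Metric.ball (0 : ℝ) ((1 / 2) ^ (j * j)) ∈ 𝓝 (0 : ℝ) :=
        Metric.ball_mem_nhds _ (by positivity)
      filter_upwards [this] with t ht
      simpa using ht
    obtain ⟨t, ht1, ht2⟩ := (hfreq.and_eventually hev).exists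
    exact ⟨t, ht2, ht1⟩
  choose t ht hne using hex
  set r : ℕ → ℝ := fun j => ‖y (t j) - y 0‖ with hr
  have hrpos : ∀ j, 0 < r j := fun j => norm_pos_iff.2 (sub_ne_zero.2 (hne j))
  set ψ : E → ℝ := fun a => ∑' j : ℕ, (1 / 2 : ℝ) ^ j * min 1 (‖a - y 0‖ / r j) with hψ
  have hnn : ∀ a j, 0 ≤ (1 / 2 : ℝ) ^ j * min 1 (‖a - y 0‖ / r j) := fun a j =>
    mul_nonneg (by positivity) (le_min zero_le_one (div_nonneg (norm_nonneg _) (hrpos j).le))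
  have hle : ∀ a j, (1 / 2 : ℝ) ^ j * min 1 (‖a - y 0‖ / r j) ≤ (1 / 2) ^ j := fun a j =>
    mul_le_of_le_one_right (by positivity) (min_le_left _ _)
  have hsum : Summable fun j : ℕ => (1 / 2 : ℝ) ^ j := summable_geometric_two
  have hψc : Continuous ψ := by
    refine continuous_tsum (fun j => ?_) hsum fun j a => ?_
    · fun_prop
    · rw [Real.norm_of_nonneg (hnn a j)]
      exact hle a j
  have hψ0 : ψ (y 0) = 0 := by simp [hψ]
  have hψj : ∀ j, (1 / 2 : ℝ) ^ j ≤ ψ (y (t j)) := fun j => by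
    have h1 : Summable fun i : ℕ => (1 / 2 : ℝ) ^ i * min 1 (‖y (t j) - y 0‖ / r i) :=
      Summable.of_nonneg_of_le (hnn _) (hle _) hsum
    have h2 := h1.le_tsum j fun i _ => hnn _ i
    have h3 : ‖y (t j) - y 0‖ / r j = 1 := div_self (hrpos j).ne'
    rw [h3, min_self, mul_one] at h2
    exact h2
  obtain ⟨k, hk⟩ := h ψ hψc
  have htlim : Tendsto t atTop (𝓝 0) := by
    refine squeeze_zero_norm (a := fun j : ℕ => (1 / 2 : ℝ) ^ j) (fun j => ?_)
      (tendsto_pow_atTop_nhds_zero_of_lt_one (by norm_num) (by norm_num))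
    rw [Real.norm_eq_abs]
    exact (ht j).le.trans (pow_le_pow_of_le_one (by norm_num) (by norm_num) (Nat.le_mul_self j))
  have htlim' : Tendsto t atTop (𝓝[≠] 0) := by
    refine tendsto_nhdsWithin_iff.2 ⟨htlim, Eventually.of_forall fun j h0 => hne j ?_⟩
    rw [show t j = 0 from h0]
  have hb := htlim'.eventually (hk.bound (show (0 : ℝ) < 1 / 2 by norm_num))
  obtain ⟨j, hj1, hj2⟩ := (hb.and (eventually_ge_atTop k)).exists
  have hA : ((1 / 2 : ℝ) ^ j) ^ k ≤ ‖‖ψ (y (t j)) - ψ (y 0)‖ ^ k‖ := by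
    rw [hψ0, sub_zero, norm_pow, norm_norm]
    exact pow_le_pow_left₀ (by positivity) ((hψj j).trans (le_abs_self _)) k
  have hB : ((1 / 2 : ℝ) ^ (j * j)) ≤ ((1 / 2 : ℝ) ^ j) ^ k := by
    rw [← pow_mul]
    exact pow_le_pow_of_le_one (by norm_num) (by norm_num) (Nat.mul_le_mul_left j hj2)
  have hC := ht j
  rw [Real.norm_eq_abs (t j)] at hj1
  have := abs_nonneg (t j)
  linarith

variable {Y : Cn.{u} n} {v : Y.carrier → E} {W : Set E}

theorem IsOpenVec.continuous (h : IsOpenVec Y v W) : @Continuous _ _ Y.topology _ v := by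
  refine @Continuous.mk _ _ Y.topology _ v fun O hO H d hd => ?_
  by_cases hne : H.set.Nonempty
  · obtain ⟨g, hg, hdg⟩ := (h.fig H d).1 hd hne
    have hc : Continuous fun x : H.set => v (d x) := by
      have : (fun x : H.set => v (d x)) = fun x : H.set => g x := funext hdg
      rw [this]
      exact hg.continuousOn.domRestrict
    exact hO.preimage hc
  · have : IsEmpty H.set := ⟨fun x => hne ⟨x.1, x.2⟩⟩
    rw [Set.eq_empty_of_isEmpty (d ⁻¹' (v ⁻¹' O))]
    exact isOpen_empty

theorem exists_lipschitz (hn : n ≠ 0) {ψ : E → G} {a : E} (hψ : ContDiffAt ℝ n ψ a) :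
    ∃ (C : NNReal), ∃ s ∈ 𝓝 a, LipschitzOnWith C ψ s := by
  have h1 : (1 : WithTop ℕ∞) ≤ n := by
    have : (1 : ℕ∞) ≤ n := Order.one_le_iff_ne_zero.2 hn
    exact_mod_cast this
  exact (hψ.of_le h1).exists_lipschitzOnWith

variable [FiniteDimensional ℝ E]

/-- The open set `W`, seen in `ℝ^k`. -/
abbrev euclObj (n : ℕ∞) (W : Set E) (hW : IsOpen W) : (OR n).Obj :=
  ⟨_, (toEuclidean (E := E)).symm ⁻¹' W, hW.preimage (toEuclidean (E := E)).symm.continuous⟩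

theorem IsOpenVec.exists_param (h : IsOpenVec Y v W) :
    ∃ d : (euclObj n W h.isOpen).set → Y.carrier, Y.IsFig _ d ∧
      ∀ x, v (d x) = (toEuclidean (E := E)).symm x.1 := by
  have : ∀ x : (euclObj n W h.isOpen).set, ∃ y, v y = (toEuclidean (E := E)).symm x.1 := fun x => by
    have hx : (toEuclidean (E := E)).symm x.1 ∈ W := x.2
    have hx' : (toEuclidean (E := E)).symm x.1 ∈ Set.range v := by
      rw [h.range]
      exact hx
    exact hx'
  choose d hd using this
  refine ⟨d, (h.fig _ _).2 fun _ => ⟨(toEuclidean (E := E)).symm, ?_, hd⟩, hd⟩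
  exact (toEuclidean (E := E)).symm.contDiff.contMDiff.contMDiffOn

theorem IsOpenVec.isOpen_image (h : IsOpenVec Y v W) {O : Set Y.carrier}
    (hO : IsOpen[Y.topology] O) : IsOpen (v '' O) := by
  obtain ⟨d, hd, hvd⟩ := h.exists_param
  have h1 : IsOpen (d ⁻¹' O) := hO _ d hd
  have h2 : IsOpen (Subtype.val '' (d ⁻¹' O)) :=
    IsOpen.isOpenMap_subtype_val (euclObj n W h.isOpen).isObj _ h1
  have h3 := h2.preimage (toEuclidean (E := E)).continuous
  convert h3 using 1
  ext a
  constructor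
  · rintro ⟨y, hy, rfl⟩
    have hmem : (toEuclidean (E := E)) (v y) ∈ (euclObj n W h.isOpen).set := by
      show (toEuclidean (E := E)).symm (toEuclidean (v y)) ∈ W
      rw [ContinuousLinearEquiv.symm_apply_apply, ← h.range]
      exact mem_range_self y
    refine ⟨⟨_, hmem⟩, ?_, rfl⟩
    have : d ⟨_, hmem⟩ = y := h.inj (by
      rw [hvd]
      exact (toEuclidean (E := E)).symm_apply_apply _)
    rw [mem_preimage, this]
    exact hy
  · rintro ⟨x, hx, hxa⟩
    refine ⟨d x, hx, ?_⟩
    rw [hvd, hxa, ContinuousLinearEquiv.symm_apply_apply]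

theorem IsOpenVec.sub (h : IsOpenVec Y v W) {O : Set Y.carrier} (hO : IsOpen[Y.topology] O) :
    IsOpenVec (Y.sub O) (fun y => v y.1) (v '' O) where
  inj _ _ hxy := Subtype.ext (h.inj hxy)
  range := by
    ext a
    constructor
    · rintro ⟨y, rfl⟩
      exact ⟨y.1, y.2, rfl⟩
    · rintro ⟨y, hy, rfl⟩
      exact ⟨⟨y, hy⟩, rfl⟩
  isOpen := h.isOpen_image hO
  fig H d := h.fig H (fun x => (d x).1)

theorem IsOpenVec.observable (h : IsOpenVec Y v W) {O : Set Y.carrier} {K : (OR n).Obj}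
    {φ : Y.carrier → Euc K.dim} (hφ : IsObservable Y O K φ) :
    ∃ ψ : E → Euc K.dim, ContDiffOn ℝ n ψ (v '' O) ∧ ∀ y ∈ O, φ y = ψ (v y) := by
  obtain ⟨d, hd, hvd⟩ := (h.sub hφ.isOpen).exists_param
  obtain ⟨g, hg, hdg⟩ := hφ.isArrow _ d hd
  have hpre : MapsTo (toEuclidean (E := E)) (v '' O)
      (euclObj n (v '' O) (h.sub hφ.isOpen).isOpen).set := fun a ha => by
    show (toEuclidean (E := E)).symm (toEuclidean a) ∈ v '' O
    rwa [ContinuousLinearEquiv.symm_apply_apply]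
  refine ⟨fun a => g (toEuclidean a), ?_, fun y hy => ?_⟩
  · exact hg.comp (toEuclidean (E := E)).contDiff.contDiffOn hpre
  · have hmem := hpre ⟨y, hy, rfl⟩
    have h1 : d ⟨_, hmem⟩ = ⟨y, hy⟩ := (h.sub hφ.isOpen).inj (by
      rw [hvd]
      exact (toEuclidean (E := E)).symm_apply_apply _)
    have h2 := hdg ⟨_, hmem⟩
    have h3 : φ (d ⟨_, hmem⟩).1 = φ y := by rw [h1]
    exact h3.symm.trans h2

theorem IsOpenVec.isObservable (h : IsOpenVec Y v W) {m : ℕ} {f : E → Euc m}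
    (hf : ContDiff ℝ n f) :
    IsObservable Y univ ⟨m, univ, isOpen_univ⟩ (fun y => f (v y)) where
  isOpen := @isOpen_univ _ Y.topology
  mapsTo _ _ := mem_univ _
  isArrow H d hd := by
    by_cases hne : H.set.Nonempty
    · obtain ⟨g, hg, hdg⟩ := (h.fig H (fun x => (d x).1)).1 hd hne
      refine ⟨f ∘ g, hf.comp_contDiffOn hg.contDiffOn, fun x => ?_⟩
      exact congrArg f (hdg x)
    · exact ⟨fun _ => 0, contDiffOn_const, fun x => (hne ⟨x.1, x.2⟩).elim⟩

theorem IsOpenVec.nilGerm (h : IsOpenVec Y v W) {x : ℝ → Y.carrier} (hx : IsNilPath Y x) :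
    NilGerm n (fun t => v (x t)) := by
  have hc : ContinuousAt (fun t => v (x t)) 0 :=
    Filter.Tendsto.comp (y := @nhds _ Y.topology (x 0))
      (@Continuous.continuousAt _ _ Y.topology _ v (x 0) h.continuous) hx.continuousAt
  refine ⟨hc, ?_, ?_⟩
  · rintro rfl
    refine eventually_const fun ψ hψ => ?_
    have hf : ContDiff ℝ ((0 : ℕ∞) : WithTop ℕ∞) (fun a => EuclideanSpace.single (0 : Fin 1) (ψ a)) := by
      refine contDiff_zero.2 ?_
      have : (fun a => EuclideanSpace.single (0 : Fin 1) (ψ a)) =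
        fun a => WithLp.toLp 2 (fun _ : Fin 1 => ψ a) := by
        ext a i
        fin_cases i
        simp
      rw [this]
      fun_prop
    obtain ⟨k, hk⟩ := hx.nilpotent univ _ _ (h.isObservable hf) (mem_univ _)
    refine ⟨k, hk.congr_left fun t => ?_⟩
    congr 1
    rw [← dist_eq_norm, PiLp.dist_single_same, dist_eq_norm]
  · obtain ⟨k, hk⟩ := hx.nilpotent univ _ _
      (h.isObservable (toEuclidean (E := E)).contDiff) (mem_univ _)
    refine ⟨k, IsBigO.trans_isLittleO ?_ hk⟩
    refine IsBigO.pow ?_ k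
    refine IsBigO.norm_norm ?_
    have := (toEuclidean (E := E)).symm.isBigO_comp
      (fun t => toEuclidean (v (x t)) - toEuclidean (v (x 0))) (𝓝[≠] (0 : ℝ))
    simpa using this

theorem IsOpenVec.isNilpotent (h : IsOpenVec Y v W) {x : ℝ → Y.carrier}
    (hx : NilGerm n (fun t => v (x t))) : IsNilPath Y x := by
  refine ⟨?_, fun O K φ hφ h0 => ?_⟩
  · intro S hS
    obtain ⟨O, hOS, hO, h0⟩ := (@mem_nhds_iff _ Y.topology (x 0) S).1 hS
    have : v '' O ∈ 𝓝 (v (x 0)) := (h.isOpen_image hO).mem_nhds ⟨_, h0, rfl⟩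
    have hev : ∀ᶠ t in 𝓝 (0 : ℝ), v (x t) ∈ v '' O := hx.1 this
    exact hev.mono fun t ⟨y, hy, hyt⟩ => hOS (by rwa [h.inj hyt] at hy)
  · by_cases hn : n = 0
    · refine ⟨1, (isLittleO_zero (fun t : ℝ => t) _).congr' ?_ EventuallyEq.rfl⟩
      filter_upwards [(hx.2.1 hn).filter_mono nhdsWithin_le_nhds] with t ht
      rw [h.inj ht]
      simp
    · obtain ⟨ψ, hψ, hφψ⟩ := h.observable hφ
      have hnhds : v '' O ∈ 𝓝 (v (x 0)) := (h.isOpen_image hφ.isOpen).mem_nhds ⟨_, h0, rfl⟩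
      obtain ⟨C, s, hs, hC⟩ := exists_lipschitz hn (hψ.contDiffAt hnhds)
      obtain ⟨k, hk⟩ := hx.2.2
      refine ⟨k, IsBigO.trans_isLittleO ?_ hk⟩
      refine IsBigO.pow (IsBigO.norm_norm (IsBigO.of_bound C ?_)) k
      have := hx.1 (inter_mem hnhds hs)
      filter_upwards [nhdsWithin_le_nhds this] with t ht
      have hO : x t ∈ O := by
        obtain ⟨y, hy, hyt⟩ := ht.1
        rwa [h.inj hyt] at hy
      rw [hφψ _ hO, hφψ _ h0]
      exact hC.norm_sub_le ht.2 (mem_of_mem_nhds hs)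

theorem IsOpenVec.sim (h : IsOpenVec Y v W) {x y : ℝ → Y.carrier}
    (hx : IsNilPath Y x) (hy : IsNilPath Y y) (h0 : v (x 0) = v (y 0))
    (hxy : (fun t => v (x t) - v (y t)) =o[𝓝[≠] 0] (fun t : ℝ => t)) : Sim Y x y := by
  have h0' := h.inj h0
  refine fun O K φ hφ => ⟨by rw [h0'], fun hxO => ?_⟩
  have gx := h.nilGerm hx
  have gy := h.nilGerm hy
  by_cases hn : n = 0
  · refine (isLittleO_zero (fun t : ℝ => t) _).congr' ?_ EventuallyEq.rfl
    filter_upwards [(gx.2.1 hn).filter_mono nhdsWithin_le_nhds,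
      (gy.2.1 hn).filter_mono nhdsWithin_le_nhds] with t ht ht'
    rw [h.inj ht, h.inj ht', h0']
    simp
  · obtain ⟨ψ, hψ, hφψ⟩ := h.observable hφ
    have hnhds : v '' O ∈ 𝓝 (v (x 0)) := (h.isOpen_image hφ.isOpen).mem_nhds ⟨_, hxO, rfl⟩
    obtain ⟨C, s, hs, hC⟩ := exists_lipschitz hn (hψ.contDiffAt hnhds)
    refine IsBigO.trans_isLittleO (IsBigO.of_bound C ?_) hxy
    have h1 := gx.1 (inter_mem hnhds hs)
    have h2 := gy.1 (show v '' O ∩ s ∈ 𝓝 (v (y 0)) from h0 ▸ inter_mem hnhds hs)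
    have hmemO : ∀ z, v z ∈ v '' O → z ∈ O := fun z ⟨y, hy, hyz⟩ => by rwa [h.inj hyz] at hy
    filter_upwards [nhdsWithin_le_nhds h1, nhdsWithin_le_nhds h2] with t ht ht'
    rw [hφψ _ (hmemO _ ht.1), hφψ _ (hmemO _ ht'.1)]
    exact hC.norm_sub_le ht.2 ht'.2

theorem IsOpenVec.sim_iff (h : IsOpenVec Y v W) {x y : ℝ → Y.carrier}
    (hx : IsNilPath Y x) (hy : IsNilPath Y y) : Sim Y x y ↔ v (x 0) = v (y 0) ∧
      (fun t => v (x t) - v (y t)) =o[𝓝[≠] 0] (fun t : ℝ => t) := by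
  refine ⟨fun hs => ⟨?_, ?_⟩, fun hs => h.sim hx hy hs.1 hs.2⟩
  · by_contra hne
    have hopen : IsOpen[Y.topology] (v ⁻¹' {v (y 0)}ᶜ) :=
      @IsOpen.preimage _ _ Y.topology _ v h.continuous _ isOpen_compl_singleton
    have hobs : IsObservable Y (v ⁻¹' {v (y 0)}ᶜ) ⟨0, univ, isOpen_univ⟩ (fun _ => 0) :=
      ⟨hopen, fun _ _ => mem_univ _, fun H d _ => ⟨fun _ => 0, contDiffOn_const, fun _ => rfl⟩⟩
    exact (hs _ _ _ hobs).1.1 hne rfl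
  · have h1 := (hs univ _ _ (h.isObservable (toEuclidean (E := E)).contDiff)).2 (mem_univ _)
    refine IsBigO.trans_isLittleO ?_ h1
    have := (toEuclidean (E := E)).symm.isBigO_comp
      (fun t => toEuclidean (v (x t)) - toEuclidean (v (y t))) (𝓝[≠] (0 : ℝ))
    simpa using this

end Vec

/-! ### Extended points of open subsets of normed spaces -/

section Value

variable {n : ℕ∞} {E : Type u} [NormedAddCommGroup E] [NormedSpace ℝ E]
  {F : Type v} [NormedAddCommGroup F] [NormedSpace ℝ F]
  {G : Type w} [NormedAddCommGroup G] [NormedSpace ℝ G]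

/-- `·U` as a subset of `·E`, for `U ⊆ E`: the image of `·U` under the extension of the
inclusion. -/
def extSet (n : ℕ∞) (U : Set E) : Set (ExtPt (vec n E)) :=
  range (ExtPt.map (X := (vec n E).sub U) (Y := vec n E) (fun z => z.1) fun _ _ h => h)

/-- `y = ·g⟨p, x⟩` for a `Cⁿ` map `g : U × V → G` and extended points `p`, `x`: here `⟨p, x⟩` is the
point of `·(U × V)` with components `p` and `x`. -/
def IsValue {U : Set E} {V : Set F} {g : E × F → G} (hg : ContDiffOn ℝ n g (U ×ˢ V))
    (p : ExtPt (vec n E)) (x : ExtPt (vec n F)) (y : ExtPt (vec n G)) : Prop :=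
  ∃ ζ : ExtPt ((vec n (E × F)).sub (U ×ˢ V)),
    ExtPt.map (Y := vec n E) _ (isArrow_of_contDiffOn contDiff_fst.contDiffOn) ζ = p ∧
    ExtPt.map (Y := vec n F) _ (isArrow_of_contDiffOn contDiff_snd.contDiffOn) ζ = x ∧
    ExtPt.map (Y := vec n G) _ (isArrow_of_contDiffOn hg) ζ = y

theorem ExtPt.exists_mk {X : Cn.{u} n} (p : ExtPt X) : ∃ (x : ℝ → X.carrier) (hx : IsNilPath X x),
    p = ExtPt.mk x hx := by
  induction p using Quotient.inductionOn with
  | h x => exact ⟨x.1, x.2, rfl⟩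

theorem NilGerm.congr {x y : ℝ → E} (hx : NilGerm n x) (h : y =ᶠ[𝓝 0] x) : NilGerm n y := by
  have h0 : y 0 = x 0 := h.self_of_nhds
  refine ⟨hx.1.congr h.symm, fun hn => ?_, ?_⟩
  · filter_upwards [hx.2.1 hn, h] with t ht ht'
    rw [ht', ht, h0]
  · obtain ⟨k, hk⟩ := hx.2.2
    refine ⟨k, hk.congr' ?_ EventuallyEq.rfl⟩
    filter_upwards [h.filter_mono nhdsWithin_le_nhds] with t ht
    rw [ht, h0]

theorem NilGerm.pow_le {x : ℝ → E} (hx : NilGerm n x) :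
    ∃ k₀ : ℕ, ∀ k ≥ k₀, (fun t => ‖x t - x 0‖ ^ k) =o[𝓝[≠] 0] (fun t : ℝ => t) := by
  obtain ⟨k₀, hk₀⟩ := hx.2.2
  refine ⟨k₀, fun k hk => IsBigO.trans_isLittleO (IsBigO.of_bound 1 ?_) hk₀⟩
  have : ∀ᶠ t in 𝓝 (0 : ℝ), dist (x t) (x 0) < 1 := Metric.tendsto_nhds.1 hx.1 1 one_pos
  filter_upwards [nhdsWithin_le_nhds this] with t ht
  rw [dist_eq_norm] at ht
  rw [norm_pow, norm_pow, norm_norm, one_mul]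
  exact pow_le_pow_of_le_one (norm_nonneg _) ht.le hk

theorem NilGerm.prodMk {x : ℝ → E} {y : ℝ → F} (hx : NilGerm n x) (hy : NilGerm n y) :
    NilGerm n (fun t => (x t, y t)) := by
  refine ⟨hx.1.prodMk hy.1, fun hn => ?_, ?_⟩
  · filter_upwards [hx.2.1 hn, hy.2.1 hn] with t ht ht'
    rw [ht, ht']
  · obtain ⟨k, hk⟩ := hx.pow_le
    obtain ⟨l, hl⟩ := hy.pow_le
    refine ⟨k + l, IsBigO.trans_isLittleO (IsBigO.of_bound 1 ?_)
      ((hk (k + l) (by omega)).norm_left.add (hl (k + l) (by omega)).norm_left)⟩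
    refine Eventually.of_forall fun t => ?_
    simp only [norm_pow, norm_norm, one_mul, Prod.mk_sub_mk, Prod.norm_def]
    rw [Real.norm_of_nonneg (add_nonneg (pow_nonneg (norm_nonneg _) _) (pow_nonneg (norm_nonneg _) _))]
    have h1 : 0 ≤ ‖x t - x 0‖ ^ (k + l) := by positivity
    have h2 : 0 ≤ ‖y t - y 0‖ ^ (k + l) := by positivity
    rcases max_choice ‖x t - x 0‖ ‖y t - y 0‖ with h | h <;> rw [h, norm_norm]
    · exact le_add_of_nonneg_right h2
    · exact le_add_of_nonneg_left h1

variable [FiniteDimensional ℝ E] [FiniteDimensional ℝ F] [FiniteDimensional ℝ G]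

/-- A nilpotent path with `x 0 ∈ U` can be modified, away from `0`, to have values in `U`. -/
theorem exists_modify {x : ℝ → E} (hx : NilGerm n x) {U : Set E} (hU : IsOpen U) (h0 : x 0 ∈ U) :
    ∃ z : ℝ → ((vec n E).sub U).carrier, IsNilPath ((vec n E).sub U) z ∧
      (fun t => (z t).1) =ᶠ[𝓝 0] x := by
  classical
  have hev : (fun t => if x t ∈ U then x t else x 0) =ᶠ[𝓝 0] x := by
    filter_upwards [hx.1 (hU.mem_nhds h0)] with t ht
    exact if_pos ht
  refine ⟨fun t => ⟨if x t ∈ U then x t else x 0, by split_ifs with h <;> assumption⟩, ?_, hev⟩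
  exact (isOpenVec_sub hU).isNilpotent (hx.congr hev)

theorem ExtPt.mk_eq_iff {x y : ℝ → E} (hx : IsNilPath (vec n E) x) (hy : IsNilPath (vec n E) y) :
    ExtPt.mk (X := vec n E) x hx = ExtPt.mk (X := vec n E) y hy ↔ x 0 = y 0 ∧
      (fun t => x t - y t) =o[𝓝[≠] 0] (fun t : ℝ => t) :=
  ⟨fun h => (isOpenVec_vec.sim_iff hx hy).1 (Quotient.exact (s := simSetoid _) h),
    fun h => Quotient.sound (s := simSetoid _) ((isOpenVec_vec.sim_iff hx hy).2 h)⟩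

theorem mk_mem_extSet {x : ℝ → E} (hx : IsNilPath (vec n E) x) {U : Set E} (hU : IsOpen U) :
    ExtPt.mk x hx ∈ extSet n U ↔ x 0 ∈ U := by
  constructor
  · rintro ⟨ζ, hζ⟩
    obtain ⟨z, hz, rfl⟩ := ζ.exists_mk
    have hz' : IsNilPath (vec n E) (fun t => (z t).1) :=
      isOpenVec_vec.isNilpotent ((isOpenVec_sub hU).nilGerm hz)
    have := ((ExtPt.mk_eq_iff hz' hx).1 hζ).1
    rw [← this]
    exact (z 0).2
  · intro h0
    obtain ⟨z, hz, hzx⟩ := exists_modify (isOpenVec_vec.nilGerm hx) hU h0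
    exact ⟨ExtPt.mk z hz, ExtPt.mk_eq_of_eventuallyEq _ _ hzx⟩

theorem isValue_iff {U : Set E} {V : Set F} (hU : IsOpen U) (hV : IsOpen V) {g : E × F → G}
    (hg : ContDiffOn ℝ n g (U ×ˢ V)) {p : ℝ → E} (hp : IsNilPath (vec n E) p) {x : ℝ → F}
    (hx : IsNilPath (vec n F) x) (hpU : p 0 ∈ U) (hxV : x 0 ∈ V) (y : ExtPt (vec n G)) :
    IsValue hg (ExtPt.mk p hp) (ExtPt.mk x hx) y ↔
      ∃ h : IsNilPath (vec n G) (fun t => g (p t, x t)), y = ExtPt.mk (fun t => g (p t, x t)) h := by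
  have hW : IsOpen (U ×ˢ V) := hU.prod hV
  obtain ⟨z, hz, hzx⟩ := exists_modify
    ((isOpenVec_vec.nilGerm hp).prodMk (isOpenVec_vec.nilGerm hx)) hW ⟨hpU, hxV⟩
  have hgz : (fun t => g (z t).1) =ᶠ[𝓝 0] fun t => g (p t, x t) := hzx.fun_comp g
  have h1 : (fun t => (z t).1.1) =ᶠ[𝓝 0] p := hzx.fun_comp Prod.fst
  have h2 : (fun t => (z t).1.2) =ᶠ[𝓝 0] x := hzx.fun_comp Prod.snd
  have hnil : IsNilPath (vec n G) (fun t => g (p t, x t)) :=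
    (hz.map (isArrow_of_contDiffOn hg)).congr hgz.symm
  have hy : ExtPt.map (Y := vec n G) _ (isArrow_of_contDiffOn hg) (ExtPt.mk z hz) = ExtPt.mk _ hnil :=
    ExtPt.mk_eq_of_eventuallyEq _ _ hgz
  have e1 : ExtPt.map (Y := vec n E) _ (isArrow_of_contDiffOn contDiff_fst.contDiffOn)
      (ExtPt.mk z hz) = ExtPt.mk p hp := ExtPt.mk_eq_of_eventuallyEq _ _ h1
  have e2 : ExtPt.map (Y := vec n F) _ (isArrow_of_contDiffOn contDiff_snd.contDiffOn)
      (ExtPt.mk z hz) = ExtPt.mk x hx := ExtPt.mk_eq_of_eventuallyEq _ _ h2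
  constructor
  · rintro ⟨ζ, hζ1, hζ2, rfl⟩
    refine ⟨hnil, ?_⟩
    obtain ⟨w, hw, rfl⟩ := ζ.exists_mk
    have f1 := (ExtPt.mk_eq_iff (hw.map (isArrow_of_contDiffOn contDiff_fst.contDiffOn))
      (hz.map (isArrow_of_contDiffOn contDiff_fst.contDiffOn))).1 (hζ1.trans e1.symm)
    have f2 := (ExtPt.mk_eq_iff (hw.map (isArrow_of_contDiffOn contDiff_snd.contDiffOn))
      (hz.map (isArrow_of_contDiffOn contDiff_snd.contDiffOn))).1 (hζ2.trans e2.symm)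
    rw [← hy]
    congr 1
    exact Quotient.sound (s := simSetoid _) ((isOpenVec_sub hW).sim hw hz
      (Prod.ext f1.1 f2.1) (f1.2.prod_left f2.2))
  · rintro ⟨h, rfl⟩
    exact ⟨ExtPt.mk z hz, e1, e2, hy⟩

end Value

/-! ### The category of subsets of extended Euclidean spaces -/

/-- `·ℝ^k`. -/
abbrev ExtEuc (n : ℕ∞) (k : ℕ) : Type := ExtPt (vec n (Euc k))

/-- The topology on `·ℝ^k` generated by the sets `·U` for `U` open in `ℝ^k`. -/
@[reducible] def extTopology (n : ℕ∞) (k : ℕ) : TopologicalSpace (ExtEuc n k) :=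
  TopologicalSpace.generateFrom {A | ∃ U : Set (Euc k), IsOpen U ∧ A = extSet n U}

/-- `f : S → ·ℝ^l` is locally of the form `·g⟨p, -⟩`, with `p` a fixed extended parameter and `g` of
class `Cⁿ`. -/
def IsSERMor (n : ℕ∞) {k l : ℕ} (S : Set (ExtEuc n k)) (f : S → ExtEuc n l) : Prop :=
  ∀ s : S, ∃ (q : ℕ) (p : ExtEuc n q) (U : Set (Euc q)) (V : Set (Euc k))
    (g : Euc q × Euc k → Euc l) (hg : ContDiffOn ℝ n g (U ×ˢ V)), IsOpen U ∧ IsOpen V ∧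
      p ∈ extSet n U ∧ (s : ExtEuc n k) ∈ extSet n V ∧
      ∀ x : S, (x : ExtEuc n k) ∈ extSet n V → IsValue hg p x (f x)

theorem isOpen_extSet (n : ℕ∞) {k : ℕ} {U : Set (Euc k)} (hU : IsOpen U) :
    IsOpen[extTopology n k] (extSet n U) :=
  TopologicalSpace.isOpen_generateFrom_of_mem ⟨U, hU, rfl⟩

/-- The sets `·U` form a basis. -/
theorem exists_extSet_subset {n : ℕ∞} {k : ℕ} {A : Set (ExtEuc n k)}
    (hA : IsOpen[extTopology n k] A) : ∀ x ∈ A, ∃ U : Set (Euc k), IsOpen U ∧ x ∈ extSet n U ∧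
      extSet n U ⊆ A := by
  induction hA with
  | basic A hA =>
    obtain ⟨U, hU, rfl⟩ := hA
    exact fun x hx => ⟨U, hU, hx, subset_rfl⟩
  | univ =>
    intro x _
    obtain ⟨ξ, hξ, rfl⟩ := x.exists_mk
    exact ⟨univ, isOpen_univ, (mk_mem_extSet hξ isOpen_univ).2 (mem_univ _), subset_univ _⟩
  | inter A B _ _ hA hB =>
    intro x hx
    obtain ⟨U, hU, hxU, hUA⟩ := hA x hx.1
    obtain ⟨V, hV, hxV, hVB⟩ := hB x hx.2
    refine ⟨U ∩ V, hU.inter hV, ?_, fun y hy => ?_⟩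
    · obtain ⟨ξ, hξ, rfl⟩ := x.exists_mk
      exact (mk_mem_extSet hξ (hU.inter hV)).2
        ⟨(mk_mem_extSet hξ hU).1 hxU, (mk_mem_extSet hξ hV).1 hxV⟩
    · obtain ⟨η, hη, rfl⟩ := y.exists_mk
      have := (mk_mem_extSet hη (hU.inter hV)).1 hy
      exact ⟨hUA ((mk_mem_extSet hη hU).2 this.1), hVB ((mk_mem_extSet hη hV).2 this.2)⟩
  | sUnion T _ ih =>
    rintro x ⟨A, hAT, hxA⟩
    obtain ⟨U, hU, hxU, hUA⟩ := ih A hAT x hxA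
    exact ⟨U, hU, hxU, hUA.trans (subset_sUnion_of_mem hAT)⟩

theorem isSERMor_val (n : ℕ∞) {k : ℕ} (S : Set (ExtEuc n k)) : IsSERMor n S Subtype.val := by
  intro s
  obtain ⟨σ, hσ, hsσ⟩ := (s : ExtEuc n k).exists_mk
  have h0 : IsNilPath (vec n (Euc 0)) (fun _ => (0 : Euc 0)) :=
    isOpenVec_vec.isNilpotent
      ⟨continuousAt_const, fun _ => Eventually.of_forall fun _ => rfl, 1, by simp⟩
  refine ⟨0, ExtPt.mk _ h0, univ, univ, Prod.snd, contDiff_snd.contDiffOn, isOpen_univ, isOpen_univ,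
    (mk_mem_extSet h0 isOpen_univ).2 (mem_univ _), ?_, fun x _ => ?_⟩
  · rw [hsσ]
    exact (mk_mem_extSet hσ isOpen_univ).2 (mem_univ _)
  · obtain ⟨ξ, hξ, hxξ⟩ := (x : ExtEuc n k).exists_mk
    rw [hxξ]
    exact (isValue_iff isOpen_univ isOpen_univ _ h0 hξ (mem_univ _) (mem_univ _) _).2 ⟨hξ, rfl⟩

theorem isSERMor_const (n : ℕ∞) {k l : ℕ} (S : Set (ExtEuc n k)) (c : ExtEuc n l) :
    IsSERMor n S fun _ => c := by
  intro s
  obtain ⟨σ, hσ, hsσ⟩ := (s : ExtEuc n k).exists_mk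
  obtain ⟨γ, hγ, rfl⟩ := c.exists_mk
  refine ⟨l, ExtPt.mk γ hγ, univ, univ, Prod.fst, contDiff_fst.contDiffOn, isOpen_univ, isOpen_univ,
    (mk_mem_extSet hγ isOpen_univ).2 (mem_univ _), ?_, fun x _ => ?_⟩
  · rw [hsσ]
    exact (mk_mem_extSet hσ isOpen_univ).2 (mem_univ _)
  · obtain ⟨ξ, hξ, hxξ⟩ := (x : ExtEuc n k).exists_mk
    rw [hxξ]
    exact (isValue_iff isOpen_univ isOpen_univ _ hγ hξ (mem_univ _) (mem_univ _) _).2 ⟨hγ, rfl⟩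

/-- Near a point, `f [ξ] = [t ↦ g (p t, ξ t)]`, with values in a prescribed open set. -/
theorem IsSERMor.exists_path {n : ℕ∞} {k l : ℕ} {S : Set (ExtEuc n k)} {f : S → ExtEuc n l}
    (hf : IsSERMor n S f) (s : S) {W : Set (Euc l)} (hW : IsOpen W) (hs : f s ∈ extSet n W) :
    ∃ (q : ℕ) (p : ℝ → Euc q) (_ : IsNilPath (vec n (Euc q)) p) (U : Set (Euc q))
      (V : Set (Euc k)) (g : Euc q × Euc k → Euc l), ContDiffOn ℝ n g (U ×ˢ V) ∧ IsOpen U ∧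
      IsOpen V ∧ p 0 ∈ U ∧ (s : ExtEuc n k) ∈ extSet n V ∧ MapsTo g (U ×ˢ V) W ∧
      ∀ (ξ : ℝ → Euc k) (hξ : IsNilPath (vec n (Euc k)) ξ) (hS : ExtPt.mk ξ hξ ∈ S), ξ 0 ∈ V →
        ∃ h : IsNilPath (vec n (Euc l)) (fun t => g (p t, ξ t)),
          f ⟨ExtPt.mk ξ hξ, hS⟩ = ExtPt.mk _ h := by
  obtain ⟨q, p, U, V, g, hg, hU, hV, hpU, hsV, hval⟩ := hf s
  obtain ⟨π, hπ, rfl⟩ := p.exists_mk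
  have hπU := (mk_mem_extSet hπ hU).1 hpU
  have key : ∀ (ξ : ℝ → Euc k) (hξ : IsNilPath (vec n (Euc k)) ξ) (hS : ExtPt.mk ξ hξ ∈ S),
      ξ 0 ∈ V → ∃ h : IsNilPath (vec n (Euc l)) (fun t => g (π t, ξ t)),
          f ⟨ExtPt.mk ξ hξ, hS⟩ = ExtPt.mk _ h := fun ξ hξ hS h0 =>
    (isValue_iff hU hV hg hπ hξ hπU h0 _).1 (hval ⟨_, hS⟩ ((mk_mem_extSet hξ hV).2 h0))
  obtain ⟨s, hsS⟩ := s
  obtain ⟨σ, hσ, rfl⟩ := s.exists_mk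
  have hσV := (mk_mem_extSet hσ hV).1 hsV
  obtain ⟨hgσ, hfs⟩ := key σ hσ hsS hσV
  rw [hfs, mk_mem_extSet hgσ hW] at hs
  have hnh : g ⁻¹' W ∩ U ×ˢ V ∈ 𝓝 (π 0, σ 0) := by
    have hUV : U ×ˢ V ∈ 𝓝 (π 0, σ 0) := (hU.prod hV).mem_nhds ⟨hπU, hσV⟩
    exact inter_mem ((hg.continuousOn.continuousAt hUV) (hW.mem_nhds hs)) hUV
  obtain ⟨U', V', hU', hπU', hV', hσV', hsub⟩ := mem_nhds_prod_iff'.1 hnh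
  refine ⟨q, π, hπ, U', V', g, hg.mono fun z hz => (hsub hz).2, hU', hV', hπU',
    (mk_mem_extSet hσ hV').2 hσV', fun z hz => (hsub hz).1, fun ξ hξ hS h0 => key ξ hξ hS ?_⟩
  exact (hsub (show (π 0, ξ 0) ∈ U' ×ˢ V' from ⟨hπU', h0⟩)).2.2

theorem IsSERMor.continuous {n : ℕ∞} {k l : ℕ} {S : Set (ExtEuc n k)} {f : S → ExtEuc n l}
    (hf : IsSERMor n S f) :
    @Continuous _ _ (@instTopologicalSpaceSubtype _ _ (extTopology n k)) (extTopology n l) f := by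
  let _ := extTopology n k
  let _ := extTopology n l
  refine continuous_generateFrom_iff.2 ?_
  rintro A ⟨W, hW, rfl⟩
  refine isOpen_iff_mem_nhds.2 fun s hs => ?_
  obtain ⟨q, p, hp, U, V, g, hg, hU, hV, hpU, hsV, hmaps, hval⟩ := hf.exists_path s hW hs
  have hopen : IsOpen (Subtype.val ⁻¹' extSet n V : Set S) :=
    (isOpen_extSet n hV).preimage continuous_subtype_val
  refine Filter.mem_of_superset (hopen.mem_nhds hsV) ?_
  rintro ⟨x, hxS⟩ hxV
  obtain ⟨ξ, hξ, rfl⟩ := x.exists_mk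
  have h0 := (mk_mem_extSet hξ hV).1 hxV
  obtain ⟨h, hfx⟩ := hval ξ hξ hxS h0
  rw [mem_preimage, hfx, mk_mem_extSet h hW]
  exact hmaps ⟨hpU, h0⟩

theorem IsSERMor.comp {n : ℕ∞} {k l m : ℕ} {S : Set (ExtEuc n k)} {T : Set (ExtEuc n l)}
    {f : S → T} {g : T → ExtEuc n m} (hf : IsSERMor n S fun x => (f x : ExtEuc n l))
    (hg : IsSERMor n T g) : IsSERMor n S fun x => g (f x) := by
  intro s
  obtain ⟨c, hc⟩ : ∃ c, c = g (f s) := ⟨_, rfl⟩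
  have hcm : g (f s) ∈ extSet n (univ : Set (Euc m)) := by
    obtain ⟨γ, hγ, hcγ⟩ := (g (f s)).exists_mk
    rw [hcγ]
    exact (mk_mem_extSet hγ isOpen_univ).2 (mem_univ _)
  obtain ⟨q', π', hπ', U', V', g', hg', hU', hV', hpU', hsV', -, hval'⟩ :=
    hg.exists_path (f s) isOpen_univ hcm
  obtain ⟨q, π, hπ, U, V, g₀, hg₀, hU, hV, hpU, hsV, hmaps, hval⟩ := hf.exists_path s hV' hsV'
  let A : Euc (q' + q) ≃L[ℝ] Euc q' × Euc q := EuclideanSpace.finAddEquivProd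
  have hP : IsNilPath (vec n (Euc (q' + q))) (fun t => A.symm (π' t, π t)) := by
    have h1 : NilGerm n (fun t => (π' t, π t)) :=
      (isOpenVec_vec.nilGerm hπ').prodMk (isOpenVec_vec.nilGerm hπ)
    have h2 : IsNilPath (vec n (Euc q' × Euc q)) (fun t => (π' t, π t)) :=
      isOpenVec_vec.isNilpotent h1
    have h3 := isArrow_of_contDiffOn (n := n) (W := univ) A.symm.contDiff.contDiffOn
    exact h2.map (Y := vec n (Euc (q' + q))) (f := A.symm) fun H d hd =>
      h3 H (fun x => ⟨d x, mem_univ _⟩) hd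
  have hU'' : IsOpen (A ⁻¹' (U' ×ˢ U)) := (hU'.prod hU).preimage A.continuous
  have hPU : A.symm (π' 0, π 0) ∈ A ⁻¹' (U' ×ˢ U) := by
    rw [mem_preimage, A.apply_symm_apply]
    exact ⟨hpU', hpU⟩
  have hgg : ContDiffOn ℝ n (fun z : Euc (q' + q) × Euc k => g' ((A z.1).1, g₀ ((A z.1).2, z.2)))
      ((A ⁻¹' (U' ×ˢ U)) ×ˢ V) := by
    have hA : ContDiff ℝ n fun z : Euc (q' + q) × Euc k => A z.1 := A.contDiff.comp contDiff_fst
    have hin : ContDiffOn ℝ n (fun z : Euc (q' + q) × Euc k => g₀ ((A z.1).2, z.2))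
        ((A ⁻¹' (U' ×ˢ U)) ×ˢ V) :=
      hg₀.comp ((contDiff_snd.comp hA).prodMk contDiff_snd).contDiffOn
        fun z hz => ⟨hz.1.2, hz.2⟩
    exact hg'.comp ((contDiff_fst.comp hA).contDiffOn.prodMk hin)
      fun z hz => ⟨hz.1.1, hmaps ⟨hz.1.2, hz.2⟩⟩
  refine ⟨q' + q, ExtPt.mk _ hP, A ⁻¹' (U' ×ˢ U), V, _, hgg, hU'', hV,
    (mk_mem_extSet hP hU'').2 hPU, hsV, ?_⟩
  rintro ⟨x, hxS⟩ hxV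
  obtain ⟨ξ, hξ, rfl⟩ := x.exists_mk
  have h0 := (mk_mem_extSet hξ hV).1 hxV
  obtain ⟨h1, hfx⟩ := hval ξ hξ hxS h0
  have hfT : ExtPt.mk _ h1 ∈ T := hfx ▸ (f _).2
  obtain ⟨h2, hgx⟩ := hval' _ h1 hfT (hmaps ⟨hpU, h0⟩)
  have hfeq : f ⟨ExtPt.mk ξ hξ, hxS⟩ = ⟨ExtPt.mk _ h1, hfT⟩ := Subtype.ext hfx
  refine (isValue_iff hU'' hV hgg hP hξ hPU h0 _).2 ?_
  have hpath : (fun t => g' ((A (A.symm (π' t, π t))).1, g₀ ((A (A.symm (π' t, π t))).2, ξ t))) =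
      fun t => g' (π' t, g₀ (π t, ξ t)) := by
    funext t
    rw [A.apply_symm_apply]
  refine ⟨by rw [hpath]; exact h2, ?_⟩
  show g (f ⟨ExtPt.mk ξ hξ, hxS⟩) = _
  rw [hfeq, hgx]
  congr 1
  exact hpath.symm

theorem isSERMor_local {n : ℕ∞} {k l : ℕ} {S : Set (ExtEuc n k)} {f : S → ExtEuc n l}
    (h : ∀ x : S, ∃ U : Set (ExtEuc n k), IsOpen[extTopology n k] U ∧ (x : ExtEuc n k) ∈ U ∧
      IsSERMor n (S ∩ U) fun y => f (Set.inclusion Set.inter_subset_left y)) :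
    IsSERMor n S f := by
  intro s
  obtain ⟨A, hA, hsA, hf⟩ := h s
  obtain ⟨q, p, U, V, g, hg, hU, hV, hpU, hsV, hval⟩ := hf ⟨s.1, s.2, hsA⟩
  obtain ⟨O, hO, hsO, hOA⟩ := exists_extSet_subset hA s.1 hsA
  have hVO : IsOpen (V ∩ O) := hV.inter hO
  refine ⟨q, p, U, V ∩ O, g, hg.mono (prod_mono subset_rfl inter_subset_left), hU, hVO, hpU, ?_, ?_⟩
  · obtain ⟨s, hsS⟩ := s
    obtain ⟨σ, hσ, rfl⟩ := s.exists_mk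
    exact (mk_mem_extSet hσ hVO).2 ⟨(mk_mem_extSet hσ hV).1 hsV, (mk_mem_extSet hσ hO).1 hsO⟩
  · rintro ⟨x, hxS⟩ hxV
    obtain ⟨ξ, hξ, rfl⟩ := x.exists_mk
    obtain ⟨π, hπ, rfl⟩ := p.exists_mk
    have h0 := (mk_mem_extSet hξ hVO).1 hxV
    have hπ0 := (mk_mem_extSet hπ hU).1 hpU
    have hxA : ExtPt.mk ξ hξ ∈ A := hOA ((mk_mem_extSet hξ hO).2 h0.2)
    have := hval ⟨_, hxS, hxA⟩ ((mk_mem_extSet hξ hV).2 h0.1)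
    exact (isValue_iff hU hVO _ hπ hξ hπ0 h0 _).2
      ((isValue_iff hU hV hg hπ hξ hπ0 h0.1 _).1 this)

/-- The category of the subsets of the spaces `·ℝ^k` and of the maps which are locally of the form
`·g⟨p, -⟩`. -/
abbrev SER (n : ℕ∞) : FigCat where
  Amb := ExtEuc n
  top := extTopology n
  IsObj _ := True
  IsMor S f := IsSERMor n S f
  isObj_inter _ _ := trivial
  mor_val _ := isSERMor_val n _
  mor_comp _ _ hf hg := hf.comp hg
  mor_const c _ := isSERMor_const n _ c
  mor_cont _ hf := hf.continuous
  mor_local _ h := isSERMor_local h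

/-- The category of extended `Cⁿ` spaces. -/
abbrev ECn (n : ℕ∞) : Type (u + 1) := FSpace.{u} (SER n)

/-! ### The extension functor -/

/-- For `V` open in `ℝ^k` the inclusion `V → ℝ^k` is an arrow of `Cⁿ`. -/
theorem isArrow_incl {n : ℕ∞} (K : (OR n).Obj) :
    FSpace.IsArrow (FSpace.repr K) (vec n (Euc K.dim)) (fun z => z.1) := by
  rintro H d ⟨g, hg, hdg⟩ _
  exact ⟨g, hg.contMDiffOn, hdg⟩

/-- The generating figures of `·X`: `d : T → ·X` with `T ⊆ ·ℝ^k` is constant, or there is a figure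
`h : V → X`, with `V` open in `ℝ^k`, such that `T ⊆ ·V` and `d = ·h|_T`. -/
def IsGenFig {n : ℕ∞} (X : Cn.{u} n) (T : (SER n).Obj) (d : T.set → ExtPt X) : Prop :=
  (∃ c, d = fun _ => c) ∨
  ∃ (V : Set (Euc T.dim)) (hV : IsOpen V) (h : V → X.carrier) (hh : X.IsFig ⟨T.dim, V, hV⟩ h),
    ∀ x : T.set, ∃ ζ : ExtPt (FSpace.repr (F := OR n) ⟨T.dim, V, hV⟩),
      ExtPt.map _ (isArrow_incl ⟨T.dim, V, hV⟩) ζ = (x : ExtEuc n T.dim) ∧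
      d x = ExtPt.map h (FSpace.isArrow_of_isFig hh) ζ

/-- The extended space `·X` of a `Cⁿ` space `X`. -/
def extSpace {n : ℕ∞} (X : Cn.{u} n) : ECn.{u} n :=
  FSpace.generated (ExtPt X) (IsGenFig X) fun _ c => Or.inl ⟨c, rfl⟩

theorem isArrow_map {n : ℕ∞} {X Y : Cn.{u} n} (f : X.carrier → Y.carrier)
    (hf : FSpace.IsArrow X Y f) : FSpace.IsArrow (extSpace X) (extSpace Y) (ExtPt.map f hf) := by
  intro H δ hδ x
  obtain ⟨U, hU, hxU, K, d, g, hd, hg, hgd⟩ := hδ x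
  refine ⟨U, hU, hxU, K, fun y => ExtPt.map f hf (d y), g, ?_, hg, fun y => congrArg _ (hgd y)⟩
  rcases hd with ⟨c, rfl⟩ | ⟨V, hV, h, hh, hd⟩
  · exact Or.inl ⟨_, rfl⟩
  · refine Or.inr ⟨V, hV, fun v => f (h v), hf _ _ hh, fun y => ?_⟩
    obtain ⟨ζ, hζ, hdζ⟩ := hd y
    refine ⟨ζ, hζ, ?_⟩
    obtain ⟨z, hz, rfl⟩ := ζ.exists_mk
    exact congrArg (ExtPt.map f hf) hdζ

/-- The extension functor `·(-) : Cⁿ ⥤ ·Cⁿ`. -/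
def extFunctor (n : ℕ∞) : Cn.{u} n ⥤ ECn.{u} n where
  obj X := extSpace X
  map f := ⟨ExtPt.map f.toFun f.isArrow, isArrow_map f.toFun f.isArrow⟩
  map_id X := by
    refine FSpace.Hom.ext (funext fun p => ?_)
    obtain ⟨x, hx, rfl⟩ := ExtPt.exists_mk (X := X) p
    rfl
  map_comp f g := by
    refine FSpace.Hom.ext (funext fun p => ?_)
    obtain ⟨x, hx, rfl⟩ := ExtPt.exists_mk p
    rfl

end ExtCn

end

open ExtCn

noncomputable section

namespace ExtCn

/-! ### Open subspaces -/

/-! The arrow β costs nothing: it is the functor `·(-)` applied to the two projections, and on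
representatives it is visibly inverse to α. The content lies in α, which must be well defined and
must send figures to figures.

Well-definedness is not formal, because an observable of `X × Y` is not assembled from observables
of the factors. The only property of manifolds used is that they are locally open subsets of a
finite-dimensional normed space (`IsLocVec`). In such an open set, nilpotency becomes a condition on
norms (`NilGerm`; for `n = 0` it includes being constant near 0), and `∼` becomes equal values at 0
together with a difference `o(t)`. Both conditions can be checked componentwise. To work in a chart,
paths are modified away from 0 so that they stay in the chart domain, and observables of that open
domain are extended by a junk value to observables of the whole space. This gives
`IsLocVec.isNilPath_prodMk` and `IsLocVec.sim_prodMk`.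

For figures, one first removes the constant generators: every point of a locally Euclidean `·X` is a
value of some `·h` (`IsLocVec.exists_eq_map`), so every figure is locally `·h ∘ f`. The pair of `·h
∘ f` and `·h' ∘ f'` is then `·(h × h')` composed with the juxtaposition of `f` and `f'`, which is
again a morphism because the two extended parameters can be concatenated (`IsSERMor.append`). Hence
`IsLocVec.isArrow_pair`. Preservation of the product follows, since the comparison arrow is β. -/

/-- A figure of `X` restricts, on the open part of its domain that it sends into `U`, to a figure of
the subspace. The preimage of `O` is open in that part, hence open in the whole domain. -/
theorem FSpace.isOpen_image_val {F : FigCat} {X : FSpace.{u} F} {U : Set X.carrier}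
    (hU : IsOpen[X.topology] U) {O : Set U} (hO : IsOpen[(X.sub U).topology] O) :
    IsOpen[X.topology] (Subtype.val '' O : Set X.carrier) := by
  intro H d hd
  obtain ⟨V, hV, hVU⟩ := isOpen_induced_iff.1 (hU H d hd)
  have hmem : ∀ y : (H.sub V hV).set, d (H.incl V hV y) ∈ U := fun y => by
    have : H.incl V hV y ∈ (Subtype.val ⁻¹' V : Set H.set) := y.2.2
    rwa [hVU] at this
  obtain ⟨V', hV', hVO⟩ := isOpen_induced_iff.1
    (hO (H.sub V hV) (fun y => ⟨d (H.incl V hV y), hmem y⟩)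
      (X.fig_comp (FigCat.isHom_incl H V hV) hd))
  refine isOpen_induced_iff.2 ⟨V ∩ V', hV.inter hV', ?_⟩
  ext x
  have key : ∀ hx : (x : F.Amb H.dim) ∈ V, (x : F.Amb H.dim) ∈ V' ↔
      (⟨d x, hmem ⟨x.1, x.2, hx⟩⟩ : U) ∈ O := fun hx => by
    have := Set.ext_iff.1 hVO ⟨x.1, x.2, hx⟩
    exact this
  constructor
  · rintro ⟨h1, h2⟩
    exact ⟨_, (key h1).1 h2, rfl⟩
  · rintro ⟨y, hy, hyx⟩
    have hxU : x ∈ d ⁻¹' U := by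
      rw [mem_preimage, ← hyx]
      exact y.2
    rw [← hVU] at hxU
    refine ⟨hxU, (key hxU).2 ?_⟩
    convert hy
    exact Subtype.ext hyx.symm

/-- An observable of an open subspace is an observable of the whole space. -/
theorem IsObservable.extend {n : ℕ∞} {X : Cn.{u} n} {U : Set X.carrier}
    (hU : IsOpen[X.topology] U) {O : Set U} {K : (OR n).Obj} {φ : U → Euc K.dim}
    (hφ : IsObservable (X.sub U) O K φ) :
    IsObservable X (Subtype.val '' O) K (Function.extend Subtype.val φ fun _ => 0) where
  isOpen := FSpace.isOpen_image_val hU hφ.isOpen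
  mapsTo := by
    rintro _ ⟨y, hy, rfl⟩
    rw [Subtype.val_injective.extend_apply]
    exact hφ.mapsTo hy
  isArrow H d hd := by
    -- The figure takes values in the image of `O`, so it lifts to a figure of the iterated
    -- subspace, where `hφ` applies. The value 0 outside `U` is never met.
    have hex : ∀ x, ∃ y : U, y ∈ O ∧ y.1 = (d x).1 := fun x => (d x).2
    choose e he hed using hex
    have hfig : ((X.sub U).sub O).IsFig H fun x => ⟨e x, he x⟩ := by
      show X.IsFig H fun x => (e x).1
      rw [show (fun x => (e x).1) = fun x => (d x).1 from funext hed]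
      exact hd
    obtain ⟨g, hg, hgφ⟩ := hφ.isArrow H _ hfig
    refine ⟨g, hg, fun x => ?_⟩
    rw [← hgφ x]
    show Function.extend Subtype.val φ (fun _ => 0) (d x).1 = φ (e x)
    rw [← hed x, Subtype.val_injective.extend_apply]

/-- Openness of `U` is what makes this work: neighbourhoods and observables in the subspace come
from neighbourhoods and observables of `X`, so the subspace imposes no new test. -/
theorem IsNilPath.restrict {n : ℕ∞} {X : Cn.{u} n} {U : Set X.carrier}
    (hU : IsOpen[X.topology] U) {x : ℝ → U} (hx : IsNilPath X fun t => (x t : X.carrier)) :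
    IsNilPath (X.sub U) x := by
  refine ⟨?_, fun O K φ hφ h0 => ?_⟩
  · intro S hS
    obtain ⟨O, hOS, hO, h0⟩ := (@mem_nhds_iff _ (X.sub U).topology (x 0) S).1 hS
    have hO' : (Subtype.val '' O : Set X.carrier) ∈ @nhds _ X.topology (x 0 : X.carrier) :=
      (@IsOpen.mem_nhds_iff _ X.topology (x 0 : X.carrier) (Subtype.val '' O)
        (FSpace.isOpen_image_val hU hO)).2 ⟨_, h0, rfl⟩
    have hev : ∀ᶠ t in 𝓝 (0 : ℝ), (x t : X.carrier) ∈ (Subtype.val '' O : Set X.carrier) :=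
      hx.continuousAt hO'
    refine hev.mono fun t ht => hOS ?_
    obtain ⟨y, hy, hyt⟩ := ht
    rwa [Subtype.val_injective hyt] at hy
  · obtain ⟨k, hk⟩ := hx.nilpotent _ K _ (hφ.extend hU) ⟨_, h0, rfl⟩
    refine ⟨k, hk.congr_left fun t => ?_⟩
    rw [Subtype.val_injective.extend_apply, Subtype.val_injective.extend_apply]

theorem Sim.restrict {n : ℕ∞} {X : Cn.{u} n} {U : Set X.carrier} (hU : IsOpen[X.topology] U)
    {x y : ℝ → U} (h : Sim X (fun t => (x t : X.carrier)) fun t => (y t : X.carrier)) :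
    Sim (X.sub U) x y := by
  intro O K φ hφ
  have hmem : ∀ z : U, (z : X.carrier) ∈ (Subtype.val '' O : Set X.carrier) ↔ z ∈ O := fun z =>
    Subtype.val_injective.mem_set_image
  obtain ⟨h1, h2⟩ := h _ K _ (hφ.extend hU)
  rw [hmem, hmem] at h1
  refine ⟨h1, fun h0 => (h2 ((hmem _).2 h0)).congr_left fun t => ?_⟩
  rw [Subtype.val_injective.extend_apply, Subtype.val_injective.extend_apply]

theorem Sim.map {n : ℕ∞} {X : Cn.{u} n} {Y : Cn.{v} n} {f : X.carrier → Y.carrier}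
    (hf : FSpace.IsArrow X Y f) {x y : ℝ → X.carrier} (h : Sim X x y) :
    Sim Y (fun t => f (x t)) fun t => f (y t) :=
  fun U K φ hφ => h (f ⁻¹' U) K (fun z => φ (f z)) (hφ.comp hf)

/-- A nilpotent path starting in an open set can be modified, away from `0`, to stay in it. -/
theorem IsNilPath.exists_restrict {n : ℕ∞} {X : Cn.{u} n} {U : Set X.carrier}
    (hU : IsOpen[X.topology] U) {x : ℝ → X.carrier} (hx : IsNilPath X x) (h0 : x 0 ∈ U) :
    ∃ z : ℝ → U, IsNilPath (X.sub U) z ∧ (fun t => (z t : X.carrier)) =ᶠ[𝓝 0] x := by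
  classical
  have hev : (fun t => if x t ∈ U then x t else x 0) =ᶠ[𝓝 0] x := by
    have : ∀ᶠ t in 𝓝 (0 : ℝ), x t ∈ U :=
      hx.continuousAt ((@IsOpen.mem_nhds_iff _ X.topology (x 0) U hU).2 h0)
    filter_upwards [this] with t ht
    exact if_pos ht
  exact ⟨fun t => ⟨if x t ∈ U then x t else x 0, by split_ifs with h <;> assumption⟩,
    IsNilPath.restrict hU (hx.congr hev), hev⟩

theorem Sim.of_eventuallyEq {n : ℕ∞} {X : Cn.{u} n} {x y : ℝ → X.carrier} (hx : IsNilPath X x)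
    (hy : IsNilPath X y) (h : x =ᶠ[𝓝 0] y) : Sim X x y :=
  Quotient.exact (s := simSetoid X) (ExtPt.mk_eq_of_eventuallyEq hx hy h)

theorem Sim.trans {n : ℕ∞} {X : Cn.{u} n} {x y z : ℝ → X.carrier} (hx : IsNilPath X x)
    (hy : IsNilPath X y) (hz : IsNilPath X z) (h : Sim X x y) (h' : Sim X y z) : Sim X x z :=
  (simSetoid X).trans' (x := ⟨x, hx⟩) (y := ⟨y, hy⟩) (z := ⟨z, hz⟩) h h'

/-- `∼` depends only on germs at 0, so paths may be replaced by modifications that stay in a chart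
domain. Nilpotency enters because transitivity is taken from the setoid of nilpotent paths. -/
theorem Sim.congr {n : ℕ∞} {X : Cn.{u} n} {x y x' y' : ℝ → X.carrier} (hx : IsNilPath X x)
    (hy : IsNilPath X y) (hxx : x' =ᶠ[𝓝 0] x) (hyy : y' =ᶠ[𝓝 0] y) (h : Sim X x y) :
    Sim X x' y' :=
  have hx' := hx.congr hxx
  have hy' := hy.congr hyy
  .trans hx' hx hy' (.of_eventuallyEq hx' hx hxx)
    (.trans hx hy hy' h (.of_eventuallyEq hy hy' hyy.symm))

theorem ExtPt.mk_eq_mk {n : ℕ∞} {X : Cn.{u} n} {x y : ℝ → X.carrier} {hx : IsNilPath X x}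
    {hy : IsNilPath X y} : ExtPt.mk x hx = ExtPt.mk y hy ↔ Sim X x y :=
  ⟨fun h => Quotient.exact (s := simSetoid X) h, fun h => Quotient.sound (s := simSetoid X) h⟩

/-! ### Products of locally Euclidean spaces -/

theorem FSpace.isArrow_fst {F : FigCat} (X : FSpace.{u} F) (Y : FSpace.{v} F) :
    FSpace.IsArrow (X.prod Y) X Prod.fst := fun _ _ h => h.1

theorem FSpace.isArrow_snd {F : FigCat} (X : FSpace.{u} F) (Y : FSpace.{v} F) :
    FSpace.IsArrow (X.prod Y) Y Prod.snd := fun _ _ h => h.2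

section LocVec

variable {n : ℕ∞} {E : Type*} [NormedAddCommGroup E] [NormedSpace ℝ E]
  {E' : Type*} [NormedAddCommGroup E'] [NormedSpace ℝ E']

/-- Near each of its points, `X` is the space of an open subset of `E`. -/
def IsLocVec (X : Cn.{u} n) (E : Type*) [NormedAddCommGroup E] [NormedSpace ℝ E] : Prop :=
  ∀ a : X.carrier, ∃ U : Set X.carrier, IsOpen[X.topology] U ∧ a ∈ U ∧
    ∃ (v : U → E) (W : Set E), IsOpenVec (X.sub U) v W

theorem IsOpenVec.isLocVec {Y : Cn.{u} n} {v : Y.carrier → E} {W : Set E}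
    (h : IsOpenVec Y v W) : IsLocVec Y E := by
  refine fun a => ⟨univ, @isOpen_univ _ Y.topology, mem_univ a, fun y => v y.1, W,
    h.inj.comp Subtype.val_injective, ?_, h.isOpen, fun H d => h.fig H fun x => (d x).1⟩
  rw [← h.range]
  ext z
  simp

theorem isLocVec_vec : IsLocVec (vec n E) E := isOpenVec_vec.isLocVec

theorem isOpenVec_repr (K : (OR n).Obj) :
    IsOpenVec (FSpace.repr (F := OR n) K) (fun z => z.1) K.set := by
  refine ⟨Subtype.val_injective, Subtype.range_val, K.isObj, fun H d => ⟨?_, fun h => ?_⟩⟩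
  · rintro ⟨g, hg, hdg⟩ _
    exact ⟨g, hg.contMDiffOn, hdg⟩
  -- Figures of `vec` carry a condition only on nonempty domains, whereas a morphism of `OR n`
  -- always needs a map on the ambient space; on the empty domain 0 serves.
  · by_cases hne : H.set.Nonempty
    · obtain ⟨g, hg, hdg⟩ := h hne
      exact ⟨g, hg.contDiffOn, hdg⟩
    · exact ⟨fun _ => 0, contDiffOn_const, fun x => (hne ⟨x.1, x.2⟩).elim⟩

/-- This makes the norm criteria `IsOpenVec.isNilpotent` and `IsOpenVec.sim` available on a product
of two charts. -/
theorem IsOpenVec.prod {Y : Cn.{u} n} {v : Y.carrier → E} {W : Set E} (h : IsOpenVec Y v W)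
    {Y' : Cn.{w} n} {v' : Y'.carrier → E'} {W' : Set E'} (h' : IsOpenVec Y' v' W') :
    IsOpenVec (Y.prod Y') (Prod.map v v') (W ×ˢ W') where
  inj := h.inj.prodMap h'.inj
  range := by rw [Set.range_prodMap, h.range, h'.range]
  isOpen := h.isOpen.prod h'.isOpen
  fig H d := by
    constructor
    · rintro ⟨h1, h2⟩ hne
      obtain ⟨g, hg, hdg⟩ := (h.fig H _).1 h1 hne
      obtain ⟨g', hg', hdg'⟩ := (h'.fig H _).1 h2 hne
      exact ⟨fun z => (g z, g' z), (hg.contDiffOn.prodMk hg'.contDiffOn).contMDiffOn,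
        fun x => Prod.ext (hdg x) (hdg' x)⟩
    · intro hd
      refine ⟨(h.fig H _).2 fun hne => ?_, (h'.fig H _).2 fun hne => ?_⟩
      · obtain ⟨g, hg, hdg⟩ := hd hne
        exact ⟨fun z => (g z).1, (contDiff_fst.comp_contDiffOn hg.contDiffOn).contMDiffOn,
          fun x => congrArg Prod.fst (hdg x)⟩
      · obtain ⟨g, hg, hdg⟩ := hd hne
        exact ⟨fun z => (g z).2, (contDiff_snd.comp_contDiffOn hg.contDiffOn).contMDiffOn,
          fun x => congrArg Prod.snd (hdg x)⟩

variable [FiniteDimensional ℝ E] [FiniteDimensional ℝ E'] {X : Cn.{u} n} {Y : Cn.{w} n}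

theorem isArrow_prodMap_val (U : Set X.carrier) (V : Set Y.carrier) :
    FSpace.IsArrow ((X.sub U).prod (Y.sub V)) (X.prod Y) fun z => (z.1.1, z.2.1) :=
  fun _ _ h => h

/-- Observables of a product do not split, so the definition cannot be checked componentwise. In
charts it amounts to `NilGerm`, which is stable under pairing; the germ at 0 is then carried back to
`X × Y`. -/
theorem IsLocVec.isNilPath_prodMk (hX : IsLocVec X E) (hY : IsLocVec Y E') {x : ℝ → X.carrier}
    {y : ℝ → Y.carrier} (hx : IsNilPath X x) (hy : IsNilPath Y y) :
    IsNilPath (X.prod Y) fun t => (x t, y t) := by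
  obtain ⟨U, hU, hxU, v, W, hv⟩ := hX (x 0)
  obtain ⟨U', hU', hyU, v', W', hv'⟩ := hY (y 0)
  obtain ⟨ξ, hξ, hξx⟩ := hx.exists_restrict hU hxU
  obtain ⟨η, hη, hηy⟩ := hy.exists_restrict hU' hyU
  have hnil : IsNilPath ((X.sub U).prod (Y.sub U')) fun t => (ξ t, η t) :=
    (hv.prod hv').isNilpotent ((hv.nilGerm hξ).prodMk (hv'.nilGerm hη))
  exact (hnil.map (isArrow_prodMap_val U U')).congr (hξx.symm.prodMk hηy.symm)

/-- In charts, `∼` says that the values at 0 agree and the difference is `o(t)`, which holds for a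
pair as soon as it holds for both components. -/
theorem IsLocVec.sim_prodMk (hX : IsLocVec X E) (hY : IsLocVec Y E') {x x' : ℝ → X.carrier}
    {y y' : ℝ → Y.carrier} (hx : IsNilPath X x) (hx' : IsNilPath X x') (hy : IsNilPath Y y)
    (hy' : IsNilPath Y y') (hxx : Sim X x x') (hyy : Sim Y y y') :
    Sim (X.prod Y) (fun t => (x t, y t)) fun t => (x' t, y' t) := by
  obtain ⟨U, hU, hxU, v, W, hv⟩ := hX (x 0)
  obtain ⟨U', hU', hyU, v', W', hv'⟩ := hY (y 0)
  -- The constant observable on `U` with values in `ℝ^0` tests only membership of the starting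
  -- point. Thus both paths start in the same chart domain, with no separation axiom needed.
  have hxU' : x' 0 ∈ U := (hxx U ⟨0, univ, isOpen_univ⟩ (fun _ => 0)
    ⟨hU, fun _ _ => mem_univ _, fun H d _ => ⟨fun _ => 0, contDiffOn_const, fun _ => rfl⟩⟩).1.1 hxU
  have hyU' : y' 0 ∈ U' := (hyy U' ⟨0, univ, isOpen_univ⟩ (fun _ => 0)
    ⟨hU', fun _ _ => mem_univ _, fun H d _ => ⟨fun _ => 0, contDiffOn_const, fun _ => rfl⟩⟩).1.1 hyU
  obtain ⟨ξ, hξ, hξx⟩ := hx.exists_restrict hU hxU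
  obtain ⟨η, hη, hηy⟩ := hy.exists_restrict hU' hyU
  obtain ⟨ξ', hξ', hξx'⟩ := hx'.exists_restrict hU hxU'
  obtain ⟨η', hη', hηy'⟩ := hy'.exists_restrict hU' hyU'
  have s1 := (hv.sim_iff hξ hξ').1 (.restrict hU (hxx.congr hx hx' hξx hξx'))
  have s2 := (hv'.sim_iff hη hη').1 (.restrict hU' (hyy.congr hy hy' hηy hηy'))
  have n1 : IsNilPath ((X.sub U).prod (Y.sub U')) fun t => (ξ t, η t) :=
    (hv.prod hv').isNilpotent ((hv.nilGerm hξ).prodMk (hv'.nilGerm hη))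
  have n2 : IsNilPath ((X.sub U).prod (Y.sub U')) fun t => (ξ' t, η' t) :=
    (hv.prod hv').isNilpotent ((hv.nilGerm hξ').prodMk (hv'.nilGerm hη'))
  have hs := (hv.prod hv').sim n1 n2 (Prod.ext s1.1 s2.1) (s1.2.prod_left s2.2)
  have hval := isArrow_prodMap_val (X := X) (Y := Y) U U'
  exact (hs.map hval).congr (n1.map hval) (n2.map hval) (hξx.symm.prodMk hηy.symm)
    (hξx'.symm.prodMk hηy'.symm)

/-- The point of `·(X × Y)` with given components. -/
def ExtPt.pair (hX : IsLocVec X E) (hY : IsLocVec Y E') :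
    ExtPt X → ExtPt Y → ExtPt (X.prod Y) :=
  Quotient.map₂ (fun x y => ⟨fun t => (x.1 t, y.1 t), hX.isNilPath_prodMk hY x.2 y.2⟩)
    fun x x' h y y' h' => hX.sim_prodMk hY x.2 x'.2 y.2 y'.2 h h'

end LocVec

/-! ### Figures of extended spaces -/

section Figures

variable {n : ℕ∞} {E : Type*} [NormedAddCommGroup E] [NormedSpace ℝ E]
  {E' : Type*} [NormedAddCommGroup E'] [NormedSpace ℝ E']
  [FiniteDimensional ℝ E] [FiniteDimensional ℝ E'] {X : Cn.{u} n} {Y : Cn.{w} n}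

/-- `∼` has the same norm criterion in an open set and in the surrounding `ℝ^k`. Lifts to `·K` are
therefore unique, and arbitrarily chosen ones agree. -/
theorem map_incl_injective (K : (OR n).Obj) :
    Function.Injective (ExtPt.map _ (isArrow_incl K)) := by
  intro ζ ζ' h
  obtain ⟨z, hz, rfl⟩ := ζ.exists_mk
  obtain ⟨z', hz', rfl⟩ := ζ'.exists_mk
  obtain ⟨h0, hs⟩ := (ExtPt.mk_eq_iff (hz.map (isArrow_incl K)) (hz'.map (isArrow_incl K))).1 h
  exact ExtPt.mk_eq_mk.2 ((isOpenVec_repr K).sim hz hz' h0 hs)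

/-- Near `x`, the map `δ` is of the form `·h ∘ f` with `h` a figure of `X` and `f` a morphism. -/
def IsExtFigAt (X : Cn.{u} n) (H : (SER n).Obj) (δ : H.set → ExtPt X) (x : H.set) : Prop :=
  ∃ (A : Set ((SER n).Amb H.dim)), IsOpen[(SER n).top H.dim] A ∧ (x : (SER n).Amb H.dim) ∈ A ∧
    ∃ (K : (OR n).Obj) (h : K.set → X.carrier) (hh : X.IsFig K h)
      (f : (H.set ∩ A : Set ((SER n).Amb H.dim)) → ExtEuc n K.dim), IsSERMor n (H.set ∩ A) f ∧
      ∀ y, ∃ ζ : ExtPt (FSpace.repr (F := OR n) K), ExtPt.map _ (isArrow_incl K) ζ = f y ∧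
        δ ⟨y.1, y.2.1⟩ = ExtPt.map h (FSpace.isArrow_of_isFig hh) ζ

/-- Every subset of `·ℝ^k` is an object, so the range of `f` can serve as the domain of a generating
figure. -/
theorem isFig_extSpace_of_isExtFigAt {H : (SER n).Obj} {δ : H.set → ExtPt X}
    (hδ : ∀ x, IsExtFigAt X H δ x) : (extSpace X).IsFig H δ := by
  intro x
  obtain ⟨A, hA, hxA, K, h, hh, f, hf, hfδ⟩ := hδ x
  have hex : ∀ z : Set.range f, ∃ ζ : ExtPt (FSpace.repr (F := OR n) K),
      ExtPt.map _ (isArrow_incl K) ζ = z.1 := by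
    rintro ⟨_, y, rfl⟩
    exact (hfδ y).imp fun _ h => h.1
  choose c hc using hex
  -- The lifts chosen over the range depend only on the value of `f`; uniqueness of lifts identifies
  -- them with those given by `hfδ`.
  refine ⟨A, hA, hxA, ⟨K.dim, Set.range f, trivial⟩,
    fun z => ExtPt.map h (FSpace.isArrow_of_isFig hh) (c z), fun y => ⟨f y, y, rfl⟩,
    Or.inr ⟨K.set, K.isObj, h, hh, fun z => ⟨c z, hc z, rfl⟩⟩, hf, fun y => ?_⟩
  obtain ⟨ζ, hζ, hδζ⟩ := hfδ y
  refine hδζ.trans (congrArg _ ?_)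
  exact map_incl_injective K (hζ.trans (hc ⟨f y, y, rfl⟩).symm)

/-- Every extended point of a locally Euclidean space is a value of some `·h`. -/
theorem IsLocVec.exists_eq_map (hX : IsLocVec X E) (c : ExtPt X) :
    ∃ (K : (OR n).Obj) (h : K.set → X.carrier) (hh : X.IsFig K h)
      (ζ : ExtPt (FSpace.repr (F := OR n) K)),
      c = ExtPt.map h (FSpace.isArrow_of_isFig hh) ζ := by
  obtain ⟨γ, hγ, rfl⟩ := c.exists_mk
  obtain ⟨U, hU, h0, v, W, hv⟩ := hX (γ 0)
  obtain ⟨ξ, hξ, hξγ⟩ := hγ.exists_restrict hU h0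
  obtain ⟨d, hd, hvd⟩ := hv.exists_param
  have hmem : ∀ y : U, toEuclidean (v y) ∈ (euclObj n W hv.isOpen).set := fun y => by
    show (toEuclidean (E := E)).symm (toEuclidean (v y)) ∈ W
    rw [ContinuousLinearEquiv.symm_apply_apply, ← hv.range]
    exact mem_range_self y
  have hdv : ∀ y : U, d ⟨_, hmem y⟩ = y := fun y => hv.inj (by
    rw [hvd]
    exact (toEuclidean (E := E)).symm_apply_apply _)
  -- The chart is an arrow into its Euclidean image. The required `ζ` is the class of the image of
  -- `ξ`, and the parametrization `d` brings it back to `ξ`.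
  have hu : FSpace.IsArrow (X.sub U) (FSpace.repr (F := OR n) (euclObj n W hv.isOpen))
      fun y => ⟨_, hmem y⟩ := fun H e he => by
    refine ((isOpenVec_repr (euclObj n W hv.isOpen)).fig H _).2 fun hne => ?_
    obtain ⟨g, hg, heg⟩ := (hv.fig H e).1 he hne
    exact ⟨fun z => toEuclidean (g z),
      (toEuclidean.contDiff.comp_contDiffOn hg.contDiffOn).contMDiffOn,
      fun z => congrArg toEuclidean (heg z)⟩
  refine ⟨_, fun z => (d z).1, hd, ExtPt.mk _ (hξ.map hu), ?_⟩
  refine ExtPt.mk_eq_of_eventuallyEq _ _ ?_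
  filter_upwards [hξγ] with t ht
  rw [hdv, ht]

/-- A constant generator is `·h` composed with a constant morphism. This disposes of the mixed case
of a product figure with one constant component and one of the form `·h'|_T`, since a generating
figure of the product offers no such mixture. -/
theorem IsLocVec.isExtFigAt (hX : IsLocVec X E) {H : (SER n).Obj} {δ : H.set → ExtPt X}
    (hδ : (extSpace X).IsFig H δ) (x : H.set) : IsExtFigAt X H δ x := by
  obtain ⟨A, hA, hxA, K, d, f, hd, hf, hfd⟩ := hδ x
  refine ⟨A, hA, hxA, ?_⟩
  rcases hd with ⟨c, rfl⟩ | ⟨V, hV, h, hh, hd⟩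
  · obtain ⟨K', h, hh, ζ, rfl⟩ := hX.exists_eq_map c
    exact ⟨K', h, hh, fun _ => ExtPt.map _ (isArrow_incl K') ζ, isSERMor_const n _ _,
      fun y => ⟨ζ, rfl, hfd y⟩⟩
  · refine ⟨⟨K.dim, V, hV⟩, h, hh, fun y => (f y).1, hf, fun y => ?_⟩
    obtain ⟨ζ, hζ, hdζ⟩ := hd (f y)
    exact ⟨ζ, hζ, (hfd y).trans hdζ⟩

/-! ### Juxtaposition of Euclidean coordinates -/

theorem IsSERMor.mono {k l : ℕ} {S T : Set (ExtEuc n k)} {f : T → ExtEuc n l}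
    (hf : IsSERMor n T f) (hST : S ⊆ T) : IsSERMor n S fun x => f ⟨x.1, hST x.2⟩ := by
  intro s
  obtain ⟨q, p, U, V, g, hg, hU, hV, hpU, hsV, hval⟩ := hf ⟨s.1, hST s.2⟩
  exact ⟨q, p, U, V, g, hg, hU, hV, hpU, hsV, fun x hx => hval ⟨x.1, hST x.2⟩ hx⟩

theorem isLocVec_repr (K : (OR n).Obj) : IsLocVec (FSpace.repr (F := OR n) K) (Euc K.dim) :=
  (isOpenVec_repr K).isLocVec

/-- `ℝ^(k+l)` as a product. -/
abbrev splitEuc (k l : ℕ) : Euc (k + l) ≃L[ℝ] Euc k × Euc l := EuclideanSpace.finAddEquivProd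

theorem isArrow_splitEuc_symm (k l : ℕ) :
    FSpace.IsArrow ((vec n (Euc k)).prod (vec n (Euc l))) (vec n (Euc (k + l)))
      fun z => (splitEuc k l).symm z := by
  rintro H d ⟨h1, h2⟩ hne
  obtain ⟨g, hg, hdg⟩ := h1 hne
  obtain ⟨g', hg', hdg'⟩ := h2 hne
  refine ⟨fun x => (splitEuc k l).symm (g x, g' x),
    ((splitEuc k l).symm.contDiff.comp_contDiffOn
      (hg.contDiffOn.prodMk hg'.contDiffOn)).contMDiffOn, fun x => ?_⟩
  exact congrArg _ (Prod.ext (hdg x) (hdg' x))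

/-- The point of `·ℝ^(k+l)` with components in `·ℝ^k` and `·ℝ^l`. -/
def ExtEuc.append {k l : ℕ} (a : ExtEuc n k) (b : ExtEuc n l) : ExtEuc n (k + l) :=
  ExtPt.map (Y := vec n (Euc (k + l))) _ (isArrow_splitEuc_symm k l)
    (ExtPt.pair isLocVec_vec isLocVec_vec a b)

/-- If `f` and `f'` are locally `·g⟨p, -⟩` and `·g'⟨p', -⟩`, then their juxtaposition is given by
`(g, g')` with the concatenation of `p` and `p'` as parameter, on the intersection of the two
domains in the variable. -/
theorem IsSERMor.append {m k l : ℕ} {S : Set (ExtEuc n m)} {f : S → ExtEuc n k}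
    {f' : S → ExtEuc n l} (hf : IsSERMor n S f) (hf' : IsSERMor n S f') :
    IsSERMor n S fun x => (f x).append (f' x) := by
  intro s
  have huniv : ∀ {j : ℕ} (c : ExtEuc n j), c ∈ extSet n (univ : Set (Euc j)) := fun c => by
    obtain ⟨γ, hγ, rfl⟩ := c.exists_mk
    exact (mk_mem_extSet hγ isOpen_univ).2 (mem_univ _)
  obtain ⟨q, π, hπ, U, V, g, hg, hU, hV, hpU, hsV, -, hval⟩ :=
    hf.exists_path s isOpen_univ (huniv _)
  obtain ⟨q', π', hπ', U', V', g', hg', hU', hV', hpU', hsV', -, hval'⟩ :=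
    hf'.exists_path s isOpen_univ (huniv _)
  let A := splitEuc q q'
  let B := splitEuc k l
  have hP : IsNilPath (vec n (Euc (q + q'))) fun t => A.symm (π t, π' t) :=
    (isLocVec_vec.isNilPath_prodMk isLocVec_vec hπ hπ').map (isArrow_splitEuc_symm q q')
  have hU'' : IsOpen (A ⁻¹' (U ×ˢ U')) := (hU.prod hU').preimage A.continuous
  have hVV : IsOpen (V ∩ V') := hV.inter hV'
  have hPU : A.symm (π 0, π' 0) ∈ A ⁻¹' (U ×ˢ U') := by
    rw [mem_preimage, A.apply_symm_apply]
    exact ⟨hpU, hpU'⟩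
  have hgg : ContDiffOn ℝ n
      (fun z : Euc (q + q') × Euc m => B.symm (g ((A z.1).1, z.2), g' ((A z.1).2, z.2)))
      ((A ⁻¹' (U ×ˢ U')) ×ˢ (V ∩ V')) := by
    have hA : ContDiff ℝ n fun z : Euc (q + q') × Euc m => A z.1 := A.contDiff.comp contDiff_fst
    refine B.symm.contDiff.comp_contDiffOn (ContDiffOn.prodMk ?_ ?_)
    · exact hg.comp ((contDiff_fst.comp hA).prodMk contDiff_snd).contDiffOn
        fun z hz => ⟨hz.1.1, hz.2.1⟩
    · exact hg'.comp ((contDiff_snd.comp hA).prodMk contDiff_snd).contDiffOn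
        fun z hz => ⟨hz.1.2, hz.2.2⟩
  refine ⟨q + q', ExtPt.mk _ hP, A ⁻¹' (U ×ˢ U'), V ∩ V', _, hgg, hU'', hVV,
    (mk_mem_extSet hP hU'').2 hPU, ?_, ?_⟩
  · obtain ⟨s, hsS⟩ := s
    obtain ⟨σ, hσ, rfl⟩ := s.exists_mk
    exact (mk_mem_extSet hσ hVV).2 ⟨(mk_mem_extSet hσ hV).1 hsV, (mk_mem_extSet hσ hV').1 hsV'⟩
  · rintro ⟨x, hxS⟩ hxV
    -- One representative `ξ` feeds both local formulas, so the two values are paired along the same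
    -- path.
    obtain ⟨ξ, hξ, rfl⟩ := x.exists_mk
    have h0 := (mk_mem_extSet hξ hVV).1 hxV
    obtain ⟨h1, hfx⟩ := hval ξ hξ hxS h0.1
    obtain ⟨h2, hfx'⟩ := hval' ξ hξ hxS h0.2
    refine (isValue_iff hU'' hVV hgg hP hξ hPU h0 _).2 ?_
    have hpath : (fun t => B.symm (g ((A (A.symm (π t, π' t))).1, ξ t),
        g' ((A (A.symm (π t, π' t))).2, ξ t))) =
        fun t => B.symm (g (π t, ξ t), g' (π' t, ξ t)) := by
      funext t
      rw [A.apply_symm_apply]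
    have hnil := (isLocVec_vec.isNilPath_prodMk isLocVec_vec h1 h2).map
      (isArrow_splitEuc_symm k l)
    refine ⟨by rw [hpath]; exact hnil, ?_⟩
    show (f _).append (f' _) = _
    rw [hfx, hfx']
    refine Eq.trans (b := ExtPt.mk _ hnil) rfl ?_
    congr 1
    exact hpath.symm

/-- The product of two objects of the category of open sets and `Cⁿ` maps. -/
def prodObj (K L : (OR n).Obj) : (OR n).Obj :=
  ⟨K.dim + L.dim, splitEuc K.dim L.dim ⁻¹' (K.set ×ˢ L.set),
    (IsOpen.prod K.isObj L.isObj).preimage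
      (splitEuc K.dim L.dim).continuous⟩

theorem isFig_prodObj {K L : (OR n).Obj} {h : K.set → X.carrier} {h' : L.set → Y.carrier}
    (hh : X.IsFig K h) (hh' : Y.IsFig L h') : (X.prod Y).IsFig (prodObj K L) fun z =>
      (h ⟨(splitEuc K.dim L.dim z.1).1, z.2.1⟩,
        h' ⟨(splitEuc K.dim L.dim z.1).2, z.2.2⟩) := by
  have hA : ContDiff ℝ n (splitEuc K.dim L.dim) := (splitEuc K.dim L.dim).contDiff
  constructor
  · exact X.fig_comp (J := prodObj K L) (H := K)
      (f := fun z => ⟨(splitEuc K.dim L.dim z.1).1, z.2.1⟩)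
      ⟨fun z => (splitEuc K.dim L.dim z).1, (contDiff_fst.comp hA).contDiffOn, fun _ => rfl⟩ hh
  · exact Y.fig_comp (J := prodObj K L) (H := L)
      (f := fun z => ⟨(splitEuc K.dim L.dim z.1).2, z.2.2⟩)
      ⟨fun z => (splitEuc K.dim L.dim z).2, (contDiff_snd.comp hA).contDiffOn, fun _ => rfl⟩ hh'

/-- Used to merge points of `·K` and `·L` into a point over the concatenated domain, where the
product figure lives. -/
theorem isArrow_prodObj (K L : (OR n).Obj) :
    FSpace.IsArrow ((FSpace.repr (F := OR n) K).prod (FSpace.repr (F := OR n) L))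
      (FSpace.repr (F := OR n) (prodObj K L))
      fun z => ⟨(splitEuc K.dim L.dim).symm (z.1.1, z.2.1), by
        show splitEuc K.dim L.dim ((splitEuc K.dim L.dim).symm _) ∈ K.set ×ˢ L.set
        rw [ContinuousLinearEquiv.apply_symm_apply]
        exact ⟨z.1.2, z.2.2⟩⟩ := by
  rintro H d ⟨⟨g, hg, hdg⟩, ⟨g', hg', hdg'⟩⟩
  exact ⟨fun x => (splitEuc K.dim L.dim).symm (g x, g' x),
    (splitEuc K.dim L.dim).symm.contDiff.comp_contDiffOn (hg.prodMk hg'),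
    fun x => congrArg (splitEuc K.dim L.dim).symm
      (Prod.ext (hdg x) (hdg' x))⟩

/-- On representatives, both sides are the same path once splitting the concatenated coordinates is
undone. -/
theorem ExtPt.map_pair_eq (hX : IsLocVec X E) (hY : IsLocVec Y E') {K L : (OR n).Obj}
    {h : K.set → X.carrier} {h' : L.set → Y.carrier} (hh : X.IsFig K h) (hh' : Y.IsFig L h')
    (ζ : ExtPt (FSpace.repr (F := OR n) K)) (η : ExtPt (FSpace.repr (F := OR n) L)) :
    ExtPt.pair hX hY (ExtPt.map h (FSpace.isArrow_of_isFig hh) ζ)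
        (ExtPt.map h' (FSpace.isArrow_of_isFig hh') η) =
      ExtPt.map _ (FSpace.isArrow_of_isFig (isFig_prodObj hh hh'))
        (ExtPt.map _ (isArrow_prodObj K L)
          (ExtPt.pair (isLocVec_repr K) (isLocVec_repr L) ζ η)) := by
  obtain ⟨z, hz, rfl⟩ := ζ.exists_mk
  obtain ⟨y, hy, rfl⟩ := η.exists_mk
  refine ExtPt.mk_eq_of_eventuallyEq _ _ (Eventually.of_forall fun t => ?_)
  refine Prod.ext (congrArg h (Subtype.ext ?_)) (congrArg h' (Subtype.ext ?_))
  · exact (congrArg Prod.fst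
      ((splitEuc K.dim L.dim).apply_symm_apply ((z t).1, (y t).1))).symm
  · exact (congrArg Prod.snd
      ((splitEuc K.dim L.dim).apply_symm_apply ((z t).1, (y t).1))).symm

/-- Locally the components are `·h ∘ f` and `·h' ∘ f'`. Over the common neighbourhood the pair
factors through the product figure `h × h'` and the juxtaposed morphism. -/
theorem IsLocVec.isArrow_pair (hX : IsLocVec X E) (hY : IsLocVec Y E') :
    FSpace.IsArrow ((extSpace X).prod (extSpace Y)) (extSpace (X.prod Y))
      fun z => ExtPt.pair hX hY z.1 z.2 := by
  rintro H δ ⟨h1, h2⟩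
  refine isFig_extSpace_of_isExtFigAt fun x => ?_
  obtain ⟨A, hA, hxA, K, h, hh, f, hf, hfδ⟩ := hX.isExtFigAt h1 x
  obtain ⟨A', hA', hxA', K', h', hh', f', hf', hfδ'⟩ := hY.isExtFigAt h2 x
  refine ⟨A ∩ A', @IsOpen.inter _ ((SER n).top H.dim) _ _ hA hA', ⟨hxA, hxA'⟩, prodObj K K', _, isFig_prodObj hh hh', _,
    (hf.mono (inter_subset_inter_right _ inter_subset_left)).append
      (hf'.mono (inter_subset_inter_right _ inter_subset_right)), fun y => ?_⟩
  obtain ⟨ζ, hζ, hδζ⟩ := hfδ ⟨y.1, y.2.1, y.2.2.1⟩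
  obtain ⟨η, hη, hδη⟩ := hfδ' ⟨y.1, y.2.1, y.2.2.2⟩
  refine ⟨ExtPt.map _ (isArrow_prodObj K K')
    (ExtPt.pair (isLocVec_repr K) (isLocVec_repr K') ζ η), ?_, ?_⟩
  · rw [← hζ, ← hη]
    obtain ⟨z, hz, rfl⟩ := ζ.exists_mk
    obtain ⟨y, hy, rfl⟩ := η.exists_mk
    rfl
  · refine Eq.trans ?_ (ExtPt.map_pair_eq hX hY hh hh' ζ η)
    exact congrArg₂ (ExtPt.pair hX hY) hδζ hδη

end Figures

/-! ### Manifolds -/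

section Manifold

variable {n : ℕ∞} {E : Type v} [NormedAddCommGroup E] [NormedSpace ℝ E]
  {B : Type*} [TopologicalSpace B] (I : ModelWithCorners ℝ E B)
  (M : Type u) [TopologicalSpace M] [ChartedSpace B M]
  {E' : Type w} [NormedAddCommGroup E'] [NormedSpace ℝ E']
  {B' : Type*} [TopologicalSpace B'] (I' : ModelWithCorners ℝ E' B')
  (N : Type u) [TopologicalSpace N] [ChartedSpace B' N]

/-- Figures of a manifold are continuous. Only this comparison of topologies is needed, to know that
chart domains are open in the final topology. -/
theorem isOpen_ofManifold {U : Set M} (hU : IsOpen U) :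
    IsOpen[(ofManifold n I M).topology] U := by
  intro H d hd
  by_cases hne : H.set.Nonempty
  · obtain ⟨g, hg, hdg⟩ := hd hne
    have hc : Continuous d := by
      rw [show d = fun x : H.set => g x from funext hdg]
      exact hg.continuousOn.domRestrict
    exact hU.preimage hc
  · have : IsEmpty H.set := ⟨fun x => hne ⟨x.1, x.2⟩⟩
    rw [Set.eq_empty_of_isEmpty (d ⁻¹' U)]
    exact isOpen_empty

/-- The extended chart and its inverse are of class `C^n`, so composition with them transports
figures both ways. Absence of boundary makes the target open in `E`. -/
theorem isOpenVec_chart [I.Boundaryless] [IsManifold I n M] (a : M) :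
    IsOpenVec ((ofManifold n I M).sub (extChartAt I a).source) (fun y => extChartAt I a y.1)
      (extChartAt I a).target where
  inj y z h := Subtype.ext ((extChartAt I a).injOn y.2 z.2 h)
  range := by
    rw [← (extChartAt I a).image_source_eq_target]
    ext z
    simp
  isOpen := isOpen_extChartAt_target a
  fig H d := by
    constructor
    · intro hd hne
      obtain ⟨g, hg, hdg⟩ := hd hne
      refine ⟨fun x => extChartAt I a (g x), ?_, fun x => congrArg (extChartAt I a) (hdg x)⟩
      refine (contMDiffOn_extChartAt (I := I) (n := n) (x := a)).comp hg fun x hx => ?_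
      have := hdg ⟨x, hx⟩
      rw [mem_preimage, ← this, ← extChartAt_source I]
      exact (d ⟨x, hx⟩).2
    · intro hd hne
      obtain ⟨g, hg, hdg⟩ := hd hne
      refine ⟨fun x => (extChartAt I a).symm (g x), ?_, fun x => ?_⟩
      · refine (contMDiffOn_extChartAt_symm (I := I) (n := n) a).comp hg fun x hx => ?_
        have := hdg ⟨x, hx⟩
        rw [mem_preimage, ← this]
        exact (extChartAt I a).map_source (d ⟨x, hx⟩).2
      · show (d x).1 = (extChartAt I a).symm (g x)
        rw [← hdg x]
        exact ((extChartAt I a).left_inv (d x).2).symm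

theorem isLocVec_ofManifold [I.Boundaryless] [IsManifold I n M] :
    IsLocVec (ofManifold n I M) E := fun a =>
  ⟨_, isOpen_ofManifold I M (isOpen_extChartAt_source a), mem_extChartAt_source a, _, _,
    isOpenVec_chart I M a⟩

/-- The space of a product of manifolds is the product of their spaces. -/
theorem isFig_ofManifold_prod (H : (OR n).Obj) (d : H.set → M × N) :
    (ofManifold n (I.prod I') (M × N)).IsFig H d ↔
      ((ofManifold n I M).prod (ofManifold n I' N)).IsFig H d := by
  constructor
  · intro hd
    refine ⟨fun hne => ?_, fun hne => ?_⟩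
    · obtain ⟨g, hg, hdg⟩ := hd hne
      exact ⟨fun x => (g x).1, contMDiff_fst.comp_contMDiffOn hg,
        fun x => congrArg Prod.fst (hdg x)⟩
    · obtain ⟨g, hg, hdg⟩ := hd hne
      exact ⟨fun x => (g x).2, contMDiff_snd.comp_contMDiffOn hg,
        fun x => congrArg Prod.snd (hdg x)⟩
  · rintro ⟨h1, h2⟩ hne
    obtain ⟨g, hg, hdg⟩ := h1 hne
    obtain ⟨g', hg', hdg'⟩ := h2 hne
    exact ⟨fun x => (g x, g' x), hg.prodMk hg', fun x => Prod.ext (hdg x) (hdg' x)⟩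

/-- The identity of `M × N` as an isomorphism between the product of the spaces of the manifolds
and the space of the product manifold. -/
def ofManifoldProdIso : (ofManifold n I M).prod (ofManifold n I' N) ≅
    ofManifold n (I.prod I') (M × N) where
  hom := ⟨fun z => z, fun H d hd => (isFig_ofManifold_prod I M I' N H d).2 hd⟩
  inv := ⟨fun z => z, fun H d hd => (isFig_ofManifold_prod I M I' N H d).1 hd⟩
  hom_inv_id := rfl
  inv_hom_id := rfl

end Manifold

/-! ### Preservation of products -/

/-- The first projection. -/
def FSpace.fst {F : FigCat} (X Y : FSpace.{u} F) : X.prod Y ⟶ X := ⟨Prod.fst, isArrow_fst X Y⟩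

/-- The second projection. -/
def FSpace.snd {F : FigCat} (X Y : FSpace.{u} F) : X.prod Y ⟶ Y := ⟨Prod.snd, isArrow_snd X Y⟩

/-- The arrow into a product with given components. -/
def FSpace.lift {F : FigCat} {T X Y : FSpace.{u} F} (f : T ⟶ X) (g : T ⟶ Y) : T ⟶ X.prod Y :=
  ⟨fun t => (f.toFun t, g.toFun t), fun H d hd => ⟨f.isArrow H d hd, g.isArrow H d hd⟩⟩

/-- `X.prod Y` is a categorical product. -/
def FSpace.prodIsLimit {F : FigCat} (X Y : FSpace.{u} F) :
    Limits.IsLimit (Limits.BinaryFan.mk (FSpace.fst X Y) (FSpace.snd X Y)) :=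
  Limits.BinaryFan.isLimitMk (fun s => FSpace.lift s.fst s.snd) (fun _ => rfl) (fun _ => rfl)
    fun s m h1 h2 => by
      rw [← h1, ← h2]
      rfl

/-! ### The comparison isomorphism and preservation of the product -/

section Iso

variable {n : ℕ∞} {E : Type*} [NormedAddCommGroup E] [NormedSpace ℝ E] [FiniteDimensional ℝ E]
  {E' : Type*} [NormedAddCommGroup E'] [NormedSpace ℝ E'] [FiniteDimensional ℝ E']
  {X Y : Cn.{u} n}

/-- `·X × ·Y ≅ ·(X × Y)` for locally Euclidean `X` and `Y`. -/
def IsLocVec.extProdIso (hX : IsLocVec X E) (hY : IsLocVec Y E') :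
    (extSpace X).prod (extSpace Y) ≅ extSpace (X.prod Y) where
  hom := ⟨fun z => ExtPt.pair hX hY z.1 z.2, hX.isArrow_pair hY⟩
  -- Being assembled from images of arrows under the functor, β needs no locally Euclidean
  -- hypothesis.
  inv := FSpace.lift ((extFunctor n).map (FSpace.fst X Y)) ((extFunctor n).map (FSpace.snd X Y))
  hom_inv_id := by
    refine FSpace.Hom.ext (funext ?_)
    rintro ⟨p, q⟩
    obtain ⟨x, hx, rfl⟩ := ExtPt.exists_mk p
    obtain ⟨y, hy, rfl⟩ := ExtPt.exists_mk q
    rfl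
  inv_hom_id := by
    refine FSpace.Hom.ext (funext fun p => ?_)
    obtain ⟨z, hz, rfl⟩ := ExtPt.exists_mk p
    rfl

/-- The image of the product cone has legs `·p_X` and `·p_Y`, the components of β. As β is
invertible, this cone is isomorphic to the product cone in the extended category. -/
theorem IsLocVec.preservesLimit_pair (hX : IsLocVec X E) (hY : IsLocVec Y E') :
    Limits.PreservesLimit (Limits.pair X Y) (extFunctor n) := by
  refine Limits.preservesLimit_of_preserves_limit_cone (FSpace.prodIsLimit X Y) ?_
  refine (Limits.isLimitMapConeBinaryFanEquiv (extFunctor n) (FSpace.fst X Y)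
    (FSpace.snd X Y)).symm ?_
  refine Limits.IsLimit.ofIsoLimit (FSpace.prodIsLimit (extSpace X) (extSpace Y)) ?_
  -- Since β followed by a projection is the corresponding leg by definition, the triangles reduce
  -- to α followed by β being the identity.
  exact Limits.BinaryFan.ext (hX.extProdIso hY)
    ((hX.extProdIso hY).hom_inv_id_assoc (FSpace.fst _ _)).symm
    ((hX.extProdIso hY).hom_inv_id_assoc (FSpace.snd _ _)).symm

end Iso

end ExtCn

end

theorem mainTheorem5 (n : ℕ∞)
    {E : Type v} [NormedAddCommGroup E] [NormedSpace ℝ E] [FiniteDimensional ℝ E]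
    {B : Type*} [TopologicalSpace B] (I : ModelWithCorners ℝ E B) [I.Boundaryless]
    (M : Type u) [TopologicalSpace M] [ChartedSpace B M] [IsManifold I n M]
    {E' : Type w} [NormedAddCommGroup E'] [NormedSpace ℝ E'] [FiniteDimensional ℝ E']
    {B' : Type*} [TopologicalSpace B'] (I' : ModelWithCorners ℝ E' B') [I'.Boundaryless]
    (N : Type u) [TopologicalSpace N] [ChartedSpace B' N] [IsManifold I' n N] :
    (∃ α : (extSpace (ofManifold n I M)).prod (extSpace (ofManifold n I' N)) ≅
        extSpace (ofManifold n (I.prod I') (M × N)),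
      (∀ (x : ℝ → M) (hx : IsNilPath (ofManifold n I M) x)
        (y : ℝ → N) (hy : IsNilPath (ofManifold n I' N) y),
        ∃ hxy : IsNilPath (ofManifold n (I.prod I') (M × N)) (fun t => (x t, y t)),
          α.hom.toFun (ExtPt.mk x hx, ExtPt.mk y hy) = ExtPt.mk (fun t => (x t, y t)) hxy) ∧
      (∀ (z : ℝ → M × N) (hz : IsNilPath (ofManifold n (I.prod I') (M × N)) z),
        ∃ (h₁ : IsNilPath (ofManifold n I M) (fun t => (z t).1))
          (h₂ : IsNilPath (ofManifold n I' N) (fun t => (z t).2)),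
          α.inv.toFun (ExtPt.mk z hz) =
            (ExtPt.mk (fun t => (z t).1) h₁, ExtPt.mk (fun t => (z t).2) h₂))) ∧
    Limits.PreservesLimit (Limits.pair (ofManifold n I M) (ofManifold n I' N)) (extFunctor n) := by

  have hM : IsLocVec (ofManifold n I M) E := isLocVec_ofManifold I M
  have hN : IsLocVec (ofManifold n I' N) E' := isLocVec_ofManifold I' N
  -- The space of the manifold `M × N` and the product of the two spaces have the same points and
  -- equivalent figure predicates, but are not the same term. The extension of the identity
  -- isomorphism bridges them without changing any path, which is why both formulas hold by `rfl`.
  refine ⟨⟨(hM.extProdIso hN).trans ((extFunctor n).mapIso (ofManifoldProdIso I M I' N)),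
    fun x hx y hy => ?_, fun z hz => ?_⟩, hM.preservesLimit_pair hN⟩
  · exact ⟨(hM.isNilPath_prodMk hN hx hy).map (ofManifoldProdIso I M I' N).hom.isArrow, rfl⟩
  · have h := hz.map (ofManifoldProdIso I M I' N).inv.isArrow
    exact ⟨h.map (FSpace.isArrow_fst _ _), h.map (FSpace.isArrow_snd _ _), rfl⟩
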